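/- **Notation.** Fix an integer $k \ge 1$. Let $W$ be the affine symmetric group, i.e. the group of permutations $w$ of $\mathbb Z$ with $w(m+k+1)=w(m)+k+1$ for all $m$ and $\sum_{m=1}^{k+1} w(m)=\sum_{m=1}^{k+1} m$. For $i\not\equiv j \pmod{k+1}$ let $t_{i,j}\in W$ be the element that interchanges $i$ and $j$ and fixes every integer congruent to neither modulo $k+1$; let $s_a=t_{a,a+1}$ (so $s_a$ depends only on $a$ modulo $k+1$), and let $\ell$ be the length function of $W$ with respect to the generators $s_0,\dots,s_k$. Let $\mathbb A$ be the affine nilCoxeter algebra over a commutative ring: it has the basis $\{\mathbf u_w : w\in W\}$ and the product $\mathbf u_v\mathbf u_w=\mathbf u_{vw}$ if $\ell(vw)=\ell(v)+\ell(w)$ and $\mathbf u_v\mathbf u_w=0$ otherwise. Write $\mathbf u_a=\mathbf u_{s_a}$. The marked strong order graph has vertex set $W$; for every pair of integers $i\le 0<j$ with $i \not\equiv j \pmod{k+1}$, $y\,t_{i,j}=x$ and $\ell(x)=\ell(y)+1$ it has an edge from $x$ to $y$ with label $y(j)$ (different pairs give different edges). A strong strip of length $n$ from $w$ to $v$ is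 a path $w=w_0\to w_1\to\cdots\to w_n=v$ in this graph whose labels strictly decrease. The linear map $D_n:\mathbb A\to\mathbb A$ sends $\mathbf u_w$ to the sum of $\mathbf u_v$ over all strong strips of length $n$ that begin at $w$, where $v$ is the end of the strip. Cells of a partition are written $(\text{row},\text{column})$, with row $1$ at the top. For a finite set $\mathcal D$ of cells, read the residues $(j-i) \bmod (k+1)$ of its cells $(i,j)$ row by row from the bottom row to the top row, and from right to left in each row; if $a_1,\dots,a_r$ are the residues so obtained, put $w_{\mathcal D}=s_{a_1}\cdots s_{a_r}\in W$ and $\mathbf u_{\mathcal D}=\mathbf u_{a_1}\cdots\mathbf u_{a_r}\in\mathbb A$. **Theorem.** Let $c\in\{0,1,\dots,k\}$, let $\lambda$ be a partition whose diagram is contained in the rectangle $(c^{k+1-c})$ with $k+1-c$ rows of length $c$, and let $n\ge 0$. Let $\mathfrak I$ be the set of all sets $X$ of $n$ distinct cells of $\lambda$ such that * (C1) no two cells of $X$ lie in the same column; * (C2) if $(i,j),(i',j')\in X$ with $i>i'$ and $j<j'$, then $(i,j')\notin\lambda$. Then $$D_n(\mathbf u_\lambda)=\sum_{X\in\mathfrak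 I}\mathbf u_{\lambda\setminus X}.$$ Moreover, there is a bijection from the set of strong strips of length $n$ that begin at $w_\lambda$ to $\mathfrak I$ such that, if the strip $w_\lambda=w_0\to w_1\to\cdots\to w_n$ corresponds to $X$, then $\mathbf u_{w_n}=\mathbf u_{\lambda\setminus X}$ and the cells of $X$ can be ordered as $x_1,\dots,x_n$ so that $w_a=w_{\lambda\setminus\{x_1,\dots,x_a\}}$ for $0\le a\le n$. -/

import Mathlib

namespace DownOp

theorem periodic_disp {k : ℕ} {w : ℤ → ℤ} (h : ∀ m, w (m + (k + 1)) = w m + (k + 1)) :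
    Function.Periodic (fun m => w m - m) ((k : ℤ) + 1) := by
  intro m
  simp only [h]
  ring

theorem periodic_eq_of_modEq {k : ℕ} {d : ℤ → ℤ} (h : Function.Periodic d ((k : ℤ) + 1))
    {a b : ℤ} (hab : a ≡ b [ZMOD (k + 1)]) : d a = d b := by
  obtain ⟨q, hq⟩ := hab.dvd
  have hb : b = a + q * ((k : ℤ) + 1) := by linarith
  rw [hb]
  exact ((h.int_mul q) a).symm

theorem sum_window_zmod {k : ℕ} {d : ℤ → ℤ} (h : Function.Periodic d ((k : ℤ) + 1)) :
    ∑ m ∈ Finset.Icc (1 : ℤ) (k + 1), d m = ∑ r : ZMod (k + 1), d r.val := by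
  have hinj : Set.InjOn (fun m : ℤ => (m : ZMod (k + 1))) (Finset.Icc (1 : ℤ) (k + 1)) := by
    intro a ha b hb hab
    simp only [Finset.coe_Icc, Set.mem_Icc] at ha hb
    have h1 := (ZMod.intCast_eq_intCast_iff a b (k + 1)).1 hab
    have h3 : (a - 1) ≡ (b - 1) [ZMOD (k + 1)] := by
      have := h1.sub_right 1
      exact_mod_cast this
    have h4 : (a - 1) % ((k : ℤ) + 1) = (b - 1) % ((k : ℤ) + 1) := h3
    rw [Int.emod_eq_of_lt (by linarith) (by linarith),
      Int.emod_eq_of_lt (by linarith) (by linarith)] at h4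
    linarith
  have himg : (Finset.Icc (1 : ℤ) (k + 1)).image (fun m : ℤ => (m : ZMod (k + 1)))
      = Finset.univ := by
    apply Finset.eq_univ_of_card
    rw [Finset.card_image_of_injOn hinj, ZMod.card]
    simp
  rw [← himg, Finset.sum_image hinj]
  refine Finset.sum_congr rfl fun m _ => periodic_eq_of_modEq h ?_
  have := ZMod.val_intCast (n := k + 1) m
  rw [this]
  push_cast
  exact (Int.mod_modEq _ _).symm

theorem modEq_apply {k : ℕ} {w : ℤ → ℤ} (h : ∀ m, w (m + (k + 1)) = w m + (k + 1)) {a b : ℤ}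
    (hab : a ≡ b [ZMOD (k + 1)]) : w a ≡ w b [ZMOD (k + 1)] := by
  have h1 : w a - a = w b - b := periodic_eq_of_modEq (periodic_disp h) hab
  have : w b - w a = b - a := by linarith
  exact Int.modEq_iff_dvd.2 (this ▸ hab.dvd)

theorem sum_window_comp {k : ℕ} {d : ℤ → ℤ} (hd : Function.Periodic d ((k : ℤ) + 1))
    (w : Equiv.Perm ℤ) (hw : ∀ m, w (m + (k + 1)) = w m + (k + 1)) :
    ∑ m ∈ Finset.Icc (1 : ℤ) (k + 1), d (w m) = ∑ m ∈ Finset.Icc (1 : ℤ) (k + 1), d m := by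
  have hdw : Function.Periodic (fun m => d (w m)) ((k : ℤ) + 1) := by
    intro m
    simp only [hw]
    exact hd _
  rw [sum_window_zmod hd, sum_window_zmod hdw]
  have hval : ∀ a : ℤ, (((a : ZMod (k + 1)).val : ℕ) : ℤ) ≡ a [ZMOD (k + 1)] := by
    intro a
    rw [ZMod.val_intCast (n := k + 1) a]
    push_cast
    exact Int.mod_modEq _ _
  have hsurj : Function.Surjective
      (fun r : ZMod (k + 1) => ((w (r.val : ℤ) : ℤ) : ZMod (k + 1))) := by
    intro r
    obtain ⟨m, hm⟩ := w.surjective (r.val : ℤ)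
    refine ⟨(m : ZMod (k + 1)), ?_⟩
    have h1 := modEq_apply hw (hval m)
    rw [hm] at h1
    have h2 : ((w ((m : ZMod (k + 1)).val : ℤ) : ℤ) : ZMod (k + 1)) = ((r.val : ℤ) : ZMod (k + 1)) :=
      (ZMod.intCast_eq_intCast_iff _ _ (k + 1)).2 (by exact_mod_cast h1)
    simpa using h2
  have hbij := Finite.injective_iff_bijective.1 (Finite.injective_iff_surjective.2 hsurj)
  rw [← hbij.sum_comp (fun r : ZMod (k + 1) => d r.val)]
  exact Finset.sum_congr rfl fun r _ => periodic_eq_of_modEq hd (hval _).symm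

/-- The affine symmetric group `W` of type `A_k^{(1)}`, as a group of permutations of `ℤ`:
`w (m + k + 1) = w m + k + 1` for all `m`, and `w 1 + ⋯ + w (k + 1) = 1 + ⋯ + (k + 1)`.
The product is composition of permutations. -/
def W (k : ℕ) : Subgroup (Equiv.Perm ℤ) where
  carrier := {w | (∀ m : ℤ, w (m + (k + 1)) = w m + (k + 1)) ∧
    ∑ m ∈ Finset.Icc (1 : ℤ) (k + 1), w m = ∑ m ∈ Finset.Icc (1 : ℤ) (k + 1), m}
  one_mem' := by simp
  mul_mem' := by
    rintro v w ⟨hv, hv'⟩ ⟨hw, hw'⟩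
    refine ⟨fun m => by simp [hw, hv], ?_⟩
    have h := sum_window_comp (periodic_disp hv) w hw
    simp only [Finset.sum_sub_distrib] at h
    simp only [Equiv.Perm.mul_apply]
    linarith
  inv_mem' := by
    rintro w ⟨hw, hw'⟩
    have hi : ∀ m : ℤ, w⁻¹ (m + (k + 1)) = w⁻¹ m + (k + 1) := by
      intro m
      rw [Equiv.Perm.inv_eq_iff_eq, hw]
      simp
    refine ⟨hi, ?_⟩
    have hs : ∀ m : ℤ, w (w⁻¹ m) = m := w.apply_symm_apply
    have h := sum_window_comp (periodic_disp hw) w⁻¹ hi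
    simp only [Finset.sum_sub_distrib, hs] at h
    linarith

/-- The permutation of `ℤ` which, for `i ≢ j` modulo `k + 1`, interchanges
`i + q (k + 1)` and `j + q (k + 1)` for all `q`, and fixes every other integer. -/
def swapFun (k : ℕ) (i j : ℤ) (m : ℤ) : ℤ :=
  if i ≡ j [ZMOD (k + 1)] then m
  else if m ≡ i [ZMOD (k + 1)] then m + (j - i)
  else if m ≡ j [ZMOD (k + 1)] then m - (j - i)
  else m

theorem swapFun_involutive (k : ℕ) (i j : ℤ) : Function.Involutive (swapFun k i j) := by
  intro m
  by_cases hij : i ≡ j [ZMOD (k + 1)]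
  · simp [swapFun, hij]
  by_cases hi : m ≡ i [ZMOD (k + 1)]
  · have h1 : m + (j - i) ≡ j [ZMOD (k + 1)] := by
      have := hi.add_right (j - i)
      simpa using this
    have h2 : ¬ m + (j - i) ≡ i [ZMOD (k + 1)] := fun h => hij (h.symm.trans h1)
    simp [swapFun, hij, hi, h1, h2]
  by_cases hj : m ≡ j [ZMOD (k + 1)]
  · have h1 : m - (j - i) ≡ i [ZMOD (k + 1)] := by
      have := hj.sub_right (j - i)
      simpa using this
    simp [swapFun, hij, hi, hj, h1]
  · simp [swapFun, hij, hi, hj]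

theorem add_period_modEq (k : ℕ) (m i : ℤ) :
    m + (k + 1) ≡ i [ZMOD (k + 1)] ↔ m ≡ i [ZMOD (k + 1)] := by
  simp [Int.ModEq]

theorem swapFun_periodic (k : ℕ) (i j m : ℤ) :
    swapFun k i j (m + (k + 1)) = swapFun k i j m + (k + 1) := by
  simp only [swapFun, add_period_modEq]
  split_ifs <;> ring

theorem sum_window_ite (k : ℕ) (i x : ℤ) :
    ∑ m ∈ Finset.Icc (1 : ℤ) (k + 1), (if m ≡ i [ZMOD (k + 1)] then x else 0) = x := by
  have hp : Function.Periodic (fun m : ℤ => if m ≡ i [ZMOD (k + 1)] then x else 0)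
      ((k : ℤ) + 1) := by
    intro m
    simp only [add_period_modEq]
  rw [sum_window_zmod hp]
  rw [Finset.sum_eq_single (i : ZMod (k + 1))]
  · rw [if_pos]
    rw [ZMod.val_intCast (n := k + 1) i]
    push_cast
    exact Int.mod_modEq _ _
  · intro r _ hr
    rw [if_neg]
    intro h
    apply hr
    have := (ZMod.intCast_eq_intCast_iff _ _ (k + 1)).2
      (show (r.val : ℤ) ≡ i [ZMOD ((k + 1 : ℕ) : ℤ)] by exact_mod_cast h)
    simpa using this
  · simp

theorem swapFun_sum (k : ℕ) (i j : ℤ) :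
    ∑ m ∈ Finset.Icc (1 : ℤ) (k + 1), swapFun k i j m = ∑ m ∈ Finset.Icc (1 : ℤ) (k + 1), m := by
  by_cases hij : i ≡ j [ZMOD (k + 1)]
  · simp [swapFun, hij]
  have h : ∀ m, swapFun k i j m = m + (if m ≡ i [ZMOD (k + 1)] then (j - i) else 0)
      + (if m ≡ j [ZMOD (k + 1)] then -(j - i) else 0) := by
    intro m
    by_cases hi : m ≡ i [ZMOD (k + 1)]
    · have hj : ¬ m ≡ j [ZMOD (k + 1)] := fun h => hij (hi.symm.trans h)
      simp [swapFun, hij, hi, hj]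
    · by_cases hj : m ≡ j [ZMOD (k + 1)]
      · simp [swapFun, hij, hi, hj]
        ring
      · simp [swapFun, hij, hi, hj]
  simp only [h, Finset.sum_add_distrib, sum_window_ite]
  ring

/-- The element `t_{i,j}` of `W` which interchanges `i` and `j` and fixes all integers congruent
to neither `i` nor `j` modulo `k + 1`; it is meant for `i ≢ j`, and is the identity otherwise. -/
def t (k : ℕ) (i j : ℤ) : W k :=
  ⟨(swapFun_involutive k i j).toPerm, swapFun_periodic k i j, swapFun_sum k i j⟩

/-- The simple generators `s_0, …, s_k` of `W`, indexed by residues modulo `k + 1`: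
`s_a = t_{a,a+1}`. -/
def s (k : ℕ) (a : ZMod (k + 1)) : W k :=
  t k a.val (a.val + 1)

/-- The Coxeter length of `w`: the least length of a word in the simple generators
whose product is `w`. -/
noncomputable def len {k : ℕ} (w : W k) : ℕ :=
  sInf {l | ∃ a : List (ZMod (k + 1)), a.length = l ∧ (a.map (s k)).prod = w}

theorem t_apply (k : ℕ) (i j m : ℤ) : (t k i j : Equiv.Perm ℤ) m = swapFun k i j m := rfl

theorem t_mul_self (k : ℕ) (i j : ℤ) : t k i j * t k i j = 1 := by
  apply Subtype.ext
  ext m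
  exact swapFun_involutive k i j m

theorem sum_sq_mul_s {k : ℕ} (hk : 1 ≤ k) (w : W k) (a : ZMod (k + 1)) :
    ∑ m ∈ Finset.Icc (1 : ℤ) (k + 1), (((w * s k a : W k) : Equiv.Perm ℤ) m - m) ^ 2
      = ∑ m ∈ Finset.Icc (1 : ℤ) (k + 1), ((w : Equiv.Perm ℤ) m - m) ^ 2
        + 2 * ((w : Equiv.Perm ℤ) (a.val + 1) - (w : Equiv.Perm ℤ) a.val) := by
  set b : ℤ := ((a.val : ℕ) : ℤ) with hb
  have hne : ¬ b ≡ b + 1 [ZMOD (k + 1)] := by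
    intro h
    have h1 := h.dvd
    have h2 := Int.le_of_dvd (by linarith) h1
    omega
  have hw := w.2.1
  have hd := periodic_disp hw
  have hs := (s k a).2.1
  have hds := periodic_disp hs
  have hp : Function.Periodic
      (fun m => ((w : Equiv.Perm ℤ) m - (s k a : Equiv.Perm ℤ) m) ^ 2) ((k : ℤ) + 1) := by
    intro m
    simp only [hw, hs]
    ring
  have h1 := sum_window_comp hp (s k a : Equiv.Perm ℤ) hs
  have h2 : ∀ m, (s k a : Equiv.Perm ℤ) ((s k a : Equiv.Perm ℤ) m) = m :=
    swapFun_involutive k _ _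
  simp only [h2] at h1
  have h3 : ∀ m, ((w : Equiv.Perm ℤ) m - (s k a : Equiv.Perm ℤ) m) ^ 2
      = ((w : Equiv.Perm ℤ) m - m) ^ 2
        + (if m ≡ b [ZMOD (k + 1)] then 1 - 2 * ((w : Equiv.Perm ℤ) b - b) else 0)
        + (if m ≡ b + 1 [ZMOD (k + 1)] then
            1 + 2 * ((w : Equiv.Perm ℤ) (b + 1) - (b + 1)) else 0) := by
    intro m
    have e : (s k a : Equiv.Perm ℤ) m = swapFun k b (b + 1) m := rfl
    rw [e]
    by_cases hm : m ≡ b [ZMOD (k + 1)]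
    · have hm' : ¬ m ≡ b + 1 [ZMOD (k + 1)] := fun h => hne (hm.symm.trans h)
      have hv : (w : Equiv.Perm ℤ) m - m = (w : Equiv.Perm ℤ) b - b :=
        periodic_eq_of_modEq hd hm
      simp only [swapFun, if_neg hne, if_pos hm, if_neg hm', ← hv]
      ring
    · by_cases hm' : m ≡ b + 1 [ZMOD (k + 1)]
      · have hv : (w : Equiv.Perm ℤ) m - m = (w : Equiv.Perm ℤ) (b + 1) - (b + 1) :=
          periodic_eq_of_modEq hd hm'
        simp only [swapFun, if_neg hne, if_neg hm, if_pos hm', ← hv]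
        ring
      · simp only [swapFun, if_neg hne, if_neg hm, if_neg hm']
        ring
  have h4 : ∀ m, ((w * s k a : W k) : Equiv.Perm ℤ) m
      = (w : Equiv.Perm ℤ) ((s k a : Equiv.Perm ℤ) m) := fun m => rfl
  simp only [h4]
  rw [h1]
  simp only [h3, Finset.sum_add_distrib, sum_window_ite]
  ring

/-- The simple generators generate `W`. -/
theorem exists_word {k : ℕ} (w : W k) :
    ∃ a : List (ZMod (k + 1)), (a.map (s k)).prod = w := by
  induction hQ : (∑ m ∈ Finset.Icc (1 : ℤ) (k + 1), ((w : Equiv.Perm ℤ) m - m) ^ 2).toNat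
    using Nat.strong_induction_on generalizing w with
  | _ Q ih =>
  have hw := w.2.1
  have hd := periodic_disp hw
  by_cases hdesc : ∃ m : ℤ, (w : Equiv.Perm ℤ) (m + 1) < (w : Equiv.Perm ℤ) m
  · obtain ⟨m, hm⟩ := hdesc
    have hk : 1 ≤ k := by
      by_contra hk
      have hk0 : k = 0 := by omega
      subst hk0
      have := hw m
      simp only [Nat.cast_zero, zero_add] at this
      linarith
    have hmod : (((m : ZMod (k + 1)).val : ℕ) : ℤ) ≡ m [ZMOD (k + 1)] := by
      rw [ZMod.val_intCast (n := k + 1) m]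
      push_cast
      exact Int.mod_modEq _ _
    have e1 : (w : Equiv.Perm ℤ) (m : ZMod (k + 1)).val - (m : ZMod (k + 1)).val
        = (w : Equiv.Perm ℤ) m - m := periodic_eq_of_modEq hd hmod
    have e2 : (w : Equiv.Perm ℤ) ((m : ZMod (k + 1)).val + 1) - ((m : ZMod (k + 1)).val + 1)
        = (w : Equiv.Perm ℤ) (m + 1) - (m + 1) :=
      periodic_eq_of_modEq hd (hmod.add_right 1)
    have hlt := sum_sq_mul_s hk w (m : ZMod (k + 1))
    have hnn : 0 ≤ ∑ n ∈ Finset.Icc (1 : ℤ) (k + 1),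
        (((w * s k (m : ZMod (k + 1)) : W k) : Equiv.Perm ℤ) n - n) ^ 2 :=
      Finset.sum_nonneg fun _ _ => sq_nonneg _
    obtain ⟨a, ha⟩ := ih _ (by rw [← hQ]; omega) (w * s k (m : ZMod (k + 1))) rfl
    refine ⟨a ++ [(m : ZMod (k + 1))], ?_⟩
    simp only [List.map_append, List.map_cons, List.map_nil, List.prod_append, ha,
      List.prod_cons, List.prod_nil, mul_one]
    rw [mul_assoc]
    have := t_mul_self k ((m : ZMod (k + 1)).val : ℤ) ((m : ZMod (k + 1)).val + 1)
    rw [show s k (m : ZMod (k + 1)) * s k (m : ZMod (k + 1)) = 1 from this, mul_one]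
  · push Not at hdesc
    have hmono : Monotone (fun m => (w : Equiv.Perm ℤ) m - m) := by
      apply monotone_int_of_le_succ
      intro m
      have h1 := hdesc m
      have h2 : (w : Equiv.Perm ℤ) m ≠ (w : Equiv.Perm ℤ) (m + 1) := by
        intro h
        have := (w : Equiv.Perm ℤ).injective h
        omega
      have h3 := lt_of_le_of_ne h1 h2
      omega
    have hconst : ∀ m, (w : Equiv.Perm ℤ) m - m = (w : Equiv.Perm ℤ) 0 - 0 := by
      intro m
      have hq : (0 : ℤ) < k + 1 := by positivity
      have e0 : (fun m => (w : Equiv.Perm ℤ) m - m) (m % (k + 1))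
          = (fun m => (w : Equiv.Perm ℤ) m - m) m :=
        periodic_eq_of_modEq hd (Int.mod_modEq _ _)
      have l1 := hmono (Int.emod_nonneg m hq.ne')
      have l2 := hmono (Int.emod_lt_of_pos m hq).le
      have e1 := hd 0
      rw [zero_add] at e1
      rw [e1] at l2
      rw [e0] at l1 l2
      exact le_antisymm l2 l1
    have hsum := w.2.2
    have hz : ∑ m ∈ Finset.Icc (1 : ℤ) (k + 1), ((w : Equiv.Perm ℤ) m - m) = 0 := by
      rw [Finset.sum_sub_distrib]
      exact sub_eq_zero.2 hsum
    rw [Finset.sum_congr rfl fun m _ => hconst m, Finset.sum_const, Int.card_Icc,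
      nsmul_eq_mul] at hz
    have hw0 : (w : Equiv.Perm ℤ) 0 - 0 = 0 := by
      rcases mul_eq_zero.1 hz with h | h
      · exfalso
        rw [Int.toNat_of_nonneg (by linarith)] at h
        linarith
      · exact h
    refine ⟨[], ?_⟩
    apply Subtype.ext
    ext m
    have := hconst m
    rw [hw0] at this
    simp only [List.map_nil, List.prod_nil, OneMemClass.coe_one, Equiv.Perm.coe_one, id_eq]
    linarith

/-- Every element of `W` has a reduced word. -/
theorem exists_reduced_word {k : ℕ} (w : W k) :
    ∃ a : List (ZMod (k + 1)), a.length = len w ∧ (a.map (s k)).prod = w := by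
  obtain ⟨a, ha⟩ := exists_word w
  exact Nat.sInf_mem (s := {l | ∃ a : List (ZMod (k + 1)), a.length = l ∧ (a.map (s k)).prod = w})
    ⟨a.length, a, rfl, ha⟩

theorem len_le_of_word {k : ℕ} (a : List (ZMod (k + 1))) : len (a.map (s k)).prod ≤ a.length :=
  Nat.sInf_le ⟨a, rfl, rfl⟩

theorem len_mul_le {k : ℕ} (v w : W k) : len (v * w) ≤ len v + len w := by
  obtain ⟨a, ha, rfl⟩ := exists_reduced_word v
  obtain ⟨b, hb, rfl⟩ := exists_reduced_word w
  rw [← ha, ← hb, ← List.length_append, ← List.prod_append, ← List.map_append]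
  exact len_le_of_word _

theorem len_one (k : ℕ) : len (1 : W k) = 0 :=
  Nat.le_zero.1 (len_le_of_word (k := k) [])

theorem finite_len_le (k L : ℕ) : {w : W k | len w ≤ L}.Finite := by
  refine ((List.finite_length_le (ZMod (k + 1)) L).image
    fun a => (a.map (s k)).prod).subset ?_
  intro w hw
  obtain ⟨a, ha, ha'⟩ := exists_reduced_word w
  exact ⟨a, by simpa [ha] using hw, ha'⟩

/-- The marked strong order graph: `IsEdge x y i j` says that the pair `i ≤ 0 < j` gives an edge
from `x` to `y`, that is, `y t_{i,j} = x` and `ℓ(x) = ℓ(y) + 1`. Different pairs give different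
edges; the edge of `(i, j)` is labelled by the integer `y j`. (A pair with `i ≡ j` modulo `k + 1`
never gives an edge, as `t k i j = 1` then.) -/
def IsEdge {k : ℕ} (x y : W k) (i j : ℤ) : Prop :=
  i ≤ 0 ∧ 0 < j ∧ y * t k i j = x ∧ len x = len y + 1

/-- A strong strip of length `n` that begins at `w`: a path with `n` edges in the marked strong
order graph, beginning at `w`, whose labels are strictly decreasing. -/
@[ext]
structure StrongStrip (k n : ℕ) (w : W k) where
  /-- the vertices `w = w_0, w_1, …, w_n` of the path -/
  vertex : Fin (n + 1) → W k
  /-- the pairs `(i, j)` that give the edges of the path -/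
  edge : Fin n → ℤ × ℤ
  vertex_zero : vertex 0 = w
  isEdge : ∀ a : Fin n, IsEdge (vertex a.castSucc) (vertex a.succ) (edge a).1 (edge a).2
  label_strictAnti : StrictAnti fun a : Fin n => (vertex a.succ : Equiv.Perm ℤ) (edge a).2

/-- The element of `W` at which a strong strip ends. -/
def StrongStrip.last {k n : ℕ} {w : W k} (p : StrongStrip k n w) : W k :=
  p.vertex (Fin.last n)

theorem finite_pairs {k : ℕ} (x y : W k) :
    {e : ℤ × ℤ | IsEdge x y e.1 e.2}.Finite := by
  have hp := periodic_disp (y⁻¹ * x).2.1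
  obtain ⟨C, hC⟩ : ∃ C : ℤ, ∀ m, ((y⁻¹ * x : W k) : Equiv.Perm ℤ) m - m ≤ C := by
    obtain ⟨C, hC⟩ := ((Finset.Icc (0 : ℤ) (k + 1)).image
      (fun m => ((y⁻¹ * x : W k) : Equiv.Perm ℤ) m - m)).bddAbove
    refine ⟨C, fun m => ?_⟩
    have e0 : (fun m => ((y⁻¹ * x : W k) : Equiv.Perm ℤ) m - m) (m % (k + 1))
        = (fun m => ((y⁻¹ * x : W k) : Equiv.Perm ℤ) m - m) m :=
      periodic_eq_of_modEq hp (Int.mod_modEq _ _)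
    have hq : (0 : ℤ) < k + 1 := by positivity
    refine e0.symm.le.trans (hC ?_)
    rw [Finset.mem_coe]
    exact Finset.mem_image_of_mem _ (Finset.mem_Icc.2
      ⟨Int.emod_nonneg m hq.ne', (Int.emod_lt_of_pos m hq).le⟩)
  refine ((Set.finite_Icc (-C) 0).prod (Set.finite_Icc 0 C)).subset ?_
  rintro ⟨i, j⟩ ⟨hi, hj, ht, hl⟩
  simp only at hi hj ht hl
  have hij : ¬ i ≡ j [ZMOD (k + 1)] := by
    intro h
    have h1 : t k i j = 1 := by
      apply Subtype.ext
      ext m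
      simp [t_apply, swapFun, h]
    rw [h1, mul_one] at ht
    rw [ht] at hl
    omega
  have h1 : y⁻¹ * x = t k i j := by rw [← ht, inv_mul_cancel_left]
  have h2 := hC i
  rw [h1, t_apply] at h2
  have h3 : swapFun k i j i = j := by
    simp [swapFun, hij]
  rw [h3] at h2
  simp only [Set.mem_prod, Set.mem_Icc]
  omega

theorem StrongStrip.len_vertex_le {k n : ℕ} {w : W k} (p : StrongStrip k n w) (a : Fin (n + 1)) :
    len (p.vertex a) ≤ len w := by
  induction a using Fin.induction with
  | zero => rw [p.vertex_zero]
  | succ a ih =>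
    have := (p.isEdge a).2.2.2
    omega

instance StrongStrip.instFinite (k n : ℕ) (w : W k) : Finite (StrongStrip k n w) := by
  set B : Set (W k) := {v | len v ≤ len w} with hB
  have hBf : B.Finite := finite_len_le k (len w)
  set E : Set (ℤ × ℤ) := ⋃ x ∈ B, ⋃ y ∈ B, {e : ℤ × ℤ | IsEdge x y e.1 e.2} with hE
  have hEf : E.Finite := hBf.biUnion fun x _ => hBf.biUnion fun y _ => finite_pairs x y
  have : Finite B := hBf
  have : Finite E := hEf
  refine Finite.of_injective (β := (Fin (n + 1) → B) × (Fin n → E)) (fun p =>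
    (fun a => ⟨p.vertex a, p.len_vertex_le a⟩, fun a => ⟨p.edge a, ?_⟩)) ?_
  · simp only [hE, Set.mem_iUnion]
    exact ⟨_, p.len_vertex_le a.castSucc, _, p.len_vertex_le a.succ, p.isEdge a⟩
  · intro p q hpq
    simp only [Prod.mk.injEq] at hpq
    ext1
    · funext a
      exact congrArg Subtype.val (congrFun hpq.1 a)
    · funext a
      exact congrArg Subtype.val (congrFun hpq.2 a)

noncomputable instance (k n : ℕ) (w : W k) : Fintype (StrongStrip k n w) :=
  Fintype.ofFinite _

/-- The affine nilCoxeter algebra `𝔸` of `W` over `R`: the free module on the basis `u_w`, `w ∈ W`,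
with the product `u_v u_w = u_{vw}` if `ℓ(vw) = ℓ(v) + ℓ(w)` and `u_v u_w = 0` otherwise. -/
def NilCox (R : Type*) [CommRing R] (k : ℕ) : Type _ := W k →₀ R

section NilCox

variable {R : Type*} [CommRing R] {k : ℕ}

noncomputable instance : AddCommGroup (NilCox R k) := inferInstanceAs (AddCommGroup (W k →₀ R))

noncomputable instance : Module R (NilCox R k) := inferInstanceAs (Module R (W k →₀ R))

/-- The basis element `u_w` of the nilCoxeter algebra. -/
noncomputable def u (R : Type*) [CommRing R] {k : ℕ} (w : W k) : NilCox R k :=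
  Finsupp.single w (1 : R)

/-- The linear map on the nilCoxeter algebra with prescribed values on the basis `u_w`. -/
noncomputable def extend {M : Type*} [AddCommGroup M] [Module R M] (f : W k → M) :
    NilCox R k →ₗ[R] M :=
  Finsupp.linearCombination R f

@[simp]
theorem extend_u {M : Type*} [AddCommGroup M] [Module R M] (f : W k → M) (w : W k) :
    extend (R := R) f (u R w) = f w := by
  change Finsupp.linearCombination R f (Finsupp.single w 1) = f w
  rw [Finsupp.linearCombination_single, one_smul]

theorem nilCox_hom_ext {M : Type*} [AddCommGroup M] [Module R M] {f g : NilCox R k →ₗ[R] M}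
    (h : ∀ w, f (u R w) = g (u R w)) : f = g :=
  Finsupp.lhom_ext' fun w => LinearMap.ext_ring (h w)

open Classical in
/-- The product of the nilCoxeter algebra on its basis. -/
noncomputable def mulBasis (R : Type*) [CommRing R] {k : ℕ} (v w : W k) : NilCox R k :=
  if len (v * w) = len v + len w then u R (v * w) else 0

/-- The product of the nilCoxeter algebra as a bilinear map. -/
noncomputable def mulHom (R : Type*) [CommRing R] (k : ℕ) :
    NilCox R k →ₗ[R] NilCox R k →ₗ[R] NilCox R k :=
  extend fun v => extend fun w => mulBasis R v w

noncomputable instance : Mul (NilCox R k) := ⟨fun a b => mulHom R k a b⟩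

noncomputable instance : One (NilCox R k) := ⟨u R 1⟩

theorem mul_def (a b : NilCox R k) : a * b = mulHom R k a b := rfl

theorem one_def : (1 : NilCox R k) = u R 1 := rfl

theorem u_mul_u (v w : W k) : u R v * u R w = mulBasis R v w := by
  simp [mul_def, mulHom]

theorem u_mul_u_of_eq {v w : W k} (h : len (v * w) = len v + len w) :
    mulHom R k (u R v) (u R w) = u R (v * w) := by
  rw [← mul_def, u_mul_u, mulBasis, if_pos h]

theorem u_mul_u_of_ne {v w : W k} (h : ¬ len (v * w) = len v + len w) :
    mulHom R k (u R v) (u R w) = 0 := by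
  rw [← mul_def, u_mul_u, mulBasis, if_neg h]

theorem mulHom_assoc_u (v w x : W k) :
    mulHom R k (mulHom R k (u R v) (u R w)) (u R x)
      = mulHom R k (u R v) (mulHom R k (u R w) (u R x)) := by
  have h1 := len_mul_le v w
  have h2 := len_mul_le w x
  have h3 := len_mul_le (v * w) x
  have h4 := len_mul_le v (w * x)
  have h5 : v * w * x = v * (w * x) := mul_assoc v w x
  rw [h5] at h3
  by_cases hvw : len (v * w) = len v + len w <;> by_cases hwx : len (w * x) = len w + len x
  · rw [u_mul_u_of_eq hvw, u_mul_u_of_eq hwx]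
    by_cases h : len (v * (w * x)) = len v + len w + len x
    · rw [u_mul_u_of_eq (by rw [h5]; omega), u_mul_u_of_eq (by omega), h5]
    · rw [u_mul_u_of_ne (by rw [h5]; omega), u_mul_u_of_ne (by omega)]
  · rw [u_mul_u_of_eq hvw, u_mul_u_of_ne hwx, map_zero, u_mul_u_of_ne (by rw [h5]; omega)]
  · rw [u_mul_u_of_ne hvw, u_mul_u_of_eq hwx, map_zero, LinearMap.zero_apply,
      u_mul_u_of_ne (by omega)]
  · rw [u_mul_u_of_ne hvw, u_mul_u_of_ne hwx, map_zero, map_zero, LinearMap.zero_apply]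

theorem nilCox_mul_assoc (a b c : NilCox R k) : a * b * c = a * (b * c) := by
  have hL : ∀ w x : W k, ∀ a : NilCox R k, a * u R w * u R x = a * (u R w * u R x) := by
    intro w x a
    have : (mulHom R k).flip (u R x) ∘ₗ (mulHom R k).flip (u R w)
        = (mulHom R k).flip (mulHom R k (u R w) (u R x)) :=
      nilCox_hom_ext fun v => mulHom_assoc_u v w x
    exact LinearMap.congr_fun this a
  have hM : ∀ x : W k, ∀ a b : NilCox R k, a * b * u R x = a * (b * u R x) := by
    intro x a b
    have : (mulHom R k).flip (u R x) ∘ₗ mulHom R k a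
        = mulHom R k a ∘ₗ (mulHom R k).flip (u R x) :=
      nilCox_hom_ext fun w => hL w x a
    exact LinearMap.congr_fun this b
  have : mulHom R k (a * b) = mulHom R k a ∘ₗ mulHom R k b :=
    nilCox_hom_ext fun x => hM x a b
  exact LinearMap.congr_fun this c

noncomputable instance : Ring (NilCox R k) :=
  { (inferInstance : AddCommGroup (NilCox R k)),
    (inferInstance : Mul (NilCox R k)),
    (inferInstance : One (NilCox R k)) with
    left_distrib := fun a b c => map_add (mulHom R k a) b c
    right_distrib := fun a b c => by simp [mul_def]
    zero_mul := fun a => by simp [mul_def]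
    mul_zero := fun a => by simp [mul_def]
    mul_assoc := nilCox_mul_assoc
    one_mul := fun a => by
      have : mulHom R k (u R 1) = LinearMap.id :=
        nilCox_hom_ext fun w => by simp [← mul_def, u_mul_u, mulBasis, len_one]
      exact LinearMap.congr_fun this a
    mul_one := fun a => by
      have : (mulHom R k).flip (u R 1) = LinearMap.id :=
        nilCox_hom_ext fun w => by simp [← mul_def, u_mul_u, mulBasis, len_one]
      exact LinearMap.congr_fun this a }

noncomputable instance : Algebra R (NilCox R k) :=
  Algebra.ofModule (fun r a b => by simp [mul_def]) (fun r a b => by simp [mul_def])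

/-- The generators `u_0, …, u_k` of the nilCoxeter algebra. -/
noncomputable def gen (R : Type*) [CommRing R] {k : ℕ} (a : ZMod (k + 1)) : NilCox R k :=
  u R (s k a)

/-- The basis element `u_w` is the product of the generators along any reduced word of `w`. -/
theorem u_eq_prod_of_reduced (a : List (ZMod (k + 1)))
    (ha : len (a.map (s k)).prod = a.length) :
    (a.map (gen R)).prod = u R (a.map (s k)).prod := by
  induction a with
  | nil => rfl
  | cons b a ih =>
    simp only [List.map_cons, List.prod_cons, List.length_cons] at ha ⊢
    have h1 := len_le_of_word a
    have h2 := len_le_of_word [b]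
    have h3 := len_mul_le (s k b) (a.map (s k)).prod
    simp only [List.map_cons, List.map_nil, List.prod_cons, List.prod_nil, mul_one,
      List.length_cons, List.length_nil] at h2
    rw [ih (by omega), gen, u_mul_u, mulBasis, if_pos (by omega)]

end NilCox

/-- The down operator `D_n : 𝔸 → 𝔸`: the linear map which sends `u_w` to the sum of `u_v` over all
strong strips of length `n` that begin at `w`, where `v` is the end of the strip. -/
noncomputable def downOp (R : Type*) [CommRing R] (k n : ℕ) : NilCox R k →ₗ[R] NilCox R k :=
  extend fun w => ∑ p : StrongStrip k n w, u R p.last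

/-- The `k`-rectangle `(c^{k+1-c})`, with `k + 1 - c` rows of length `c`. -/
def kRectangle (k c : ℕ) : YoungDiagram where
  cells := Finset.range (k + 1 - c) ×ˢ Finset.range c
  isLowerSet := by
    rintro ⟨i, j⟩ ⟨i', j'⟩ ⟨h1, h2⟩ h
    simp only [Finset.coe_product, Finset.coe_range, Set.mem_prod, Set.mem_Iio] at h h1 h2 ⊢
    omega

/-- The residue `j - i` modulo `k + 1` of the cell in row `i` and column `j`. (Rows and columns are
numbered from `0`, which does not change the difference.) -/
def residue (k : ℕ) (x : ℕ × ℕ) : ZMod (k + 1) := (x.2 : ZMod (k + 1)) - (x.1 : ZMod (k + 1))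

/-- The residues of the cells of a diagram, read row by row from the bottom row to the top row, and
from right to left in each row. -/
def readingWord (k : ℕ) (D : Finset (ℕ × ℕ)) : List (ZMod (k + 1)) :=
  ((D.map toLex.toEmbedding).sort (fun a b => a ≥ b)).map fun x => residue k (ofLex x)

/-- The element `w_D` of `W` obtained from the reading word of the diagram `D`. -/
def wOf (k : ℕ) (D : Finset (ℕ × ℕ)) : W k := ((readingWord k D).map (s k)).prod

/-- The element `u_D` of the nilCoxeter algebra obtained from the reading word of `D`. -/
noncomputable def uOf (R : Type*) [CommRing R] (k : ℕ) (D : Finset (ℕ × ℕ)) : NilCox R k :=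
  ((readingWord k D).map (gen R)).prod

/-- (C1): no two cells of `X` lie in the same column. -/
def C1 (X : Finset (ℕ × ℕ)) : Prop :=
  ∀ x ∈ X, ∀ y ∈ X, x ≠ y → x.2 ≠ y.2

/-- (C2): if `x = (i, j)` and `y = (i', j')` are cells of `X` with `i > i'` and `j < j'`, then
`(i, j')` is not a cell of `μ`. -/
def C2 (μ : YoungDiagram) (X : Finset (ℕ × ℕ)) : Prop :=
  ∀ x ∈ X, ∀ y ∈ X, y.1 < x.1 → x.2 < y.2 → (x.1, y.2) ∉ μ

open Classical in
/-- The set of all sets of `n` cells of `μ` which satisfy (C1) and (C2). -/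
noncomputable def cellSets (μ : YoungDiagram) (n : ℕ) : Finset (Finset (ℕ × ℕ)) :=
  {X ∈ μ.cells.powersetCard n | C1 X ∧ C2 μ X}

end DownOp

/-!
Let `w_λ` be the permutation of a diagram `λ` in the rectangle with `k + 1 - c` rows and `c`
columns. All residues of cells lie in `c - k, …, c - 1`, so everything takes place in the finite
symmetric group of the window `c - k, …, c`. Its positions `≤ 0` are the rows (row `r`, counted
from `0`, is the position `-r`), and its positions `> 0` are the columns (column `j` is the position
`j + 1`). In the wiring diagram given by the reading word, the wires that start at row `r` and
column `j` cross at the cell `(r, j)`, so that `w_λ(-r) = λ_r - r` and `w_λ(j+1) = j + 1 - λ'_j`.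

*Edges.* By the strong exchange property (`exists_word_mul_t`), for `i ≤ 0 < j` with `j - i ≤ k`,
`x → x t_{i,j}` is an edge exactly if `x(i) > x(j)` and no value of `x` at a position in between
lies between these two (`len_mul_t_of_between`, `len_mul_t_of_not_between`), and for `x` in the
subgroup of the window both `i` and `j` lie in the window (`isEdge_wOf_iff`). Hence an edge belongs
to a row and a column, that is, to a cell, and its label is the value which moves from the row
position to the column position.

*Deleting cells.* Multiplying by the reflection of a cell `(r, j)` deletes that cell from the
reading word if the cells to its left and those above it are still present (`wOf_erase`). In a strip
the labels decrease; so a column is used at most once, and within a row the cells are used from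
right to left, and this condition always holds. The values of `w_{λ ∖ Y}` are then given by
`wireVal` (`HasWires`): in row `r` with deleted columns `j_1 < ⋯ < j_m`, the value of row `r` has
moved to column `j_m`, that of `j_m` to `j_{m-1}`, and so on, and that of `j_1` to the row.

*Strips and cell sets.* The label of each step depends only on the set `X` of all deleted cells
(`label`), and these labels are distinct (`label_injOn`); so `X` determines the strip, which deletes
the cells of `X` in the order of decreasing labels. That no value lies in between at any step
amounts to (C2): in one direction this is `Admissible.insert_cell`, in the other
`deletable_filter_label`. Since lengths drop by one at each step and the reading word of `λ` is
reduced (`len_wOf_of_isLowerSet`), the remaining reading word is reduced, which gives `u_{λ ∖ X}`.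
-/

namespace DownOp

/-! ### Reflections and the length function -/

theorem apply_sub_modEq {k : ℕ} (g : W k) {a b : ℤ} (h : a ≡ b [ZMOD (k + 1)]) :
    (g : Equiv.Perm ℤ) a - a = (g : Equiv.Perm ℤ) b - b :=
  periodic_eq_of_modEq (periodic_disp g.2.1) h

theorem apply_modEq_iff {k : ℕ} (g : W k) {a b : ℤ} :
    (g : Equiv.Perm ℤ) a ≡ (g : Equiv.Perm ℤ) b [ZMOD (k + 1)] ↔ a ≡ b [ZMOD (k + 1)] := by
  refine ⟨fun h => ?_, fun h => modEq_apply g.2.1 h⟩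
  have := modEq_apply (g⁻¹).2.1 h
  simpa using this

/-- Conjugating `t_{i,j}` by `g` gives `t_{g(i),g(j)}`. -/
theorem mul_t_eq {k : ℕ} (g : W k) {i j : ℤ} (hij : ¬ i ≡ j [ZMOD (k + 1)]) :
    g * t k i j = t k ((g : Equiv.Perm ℤ) i) ((g : Equiv.Perm ℤ) j) * g := by
  apply Subtype.ext
  ext m
  change (g : Equiv.Perm ℤ) (swapFun k i j m) = swapFun k _ _ ((g : Equiv.Perm ℤ) m)
  simp only [swapFun, if_neg hij, apply_modEq_iff]
  split_ifs with h1 h2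
  · have e1 := apply_sub_modEq g h1
    have e2 : (g : Equiv.Perm ℤ) (m + (j - i)) - (m + (j - i)) = (g : Equiv.Perm ℤ) j - j :=
      apply_sub_modEq g (by simpa using h1.add_right (j - i))
    linarith
  · have e1 := apply_sub_modEq g h2
    have e2 : (g : Equiv.Perm ℤ) (m - (j - i)) - (m - (j - i)) = (g : Equiv.Perm ℤ) i - i :=
      apply_sub_modEq g (by simpa using h2.sub_right (j - i))
    linarith
  · rfl

theorem not_modEq_of_lt {k : ℕ} {i j : ℤ} (h1 : i < j) (h2 : j - i ≤ k) :
    ¬ i ≡ j [ZMOD (k + 1)] := by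
  intro h
  have := Int.le_of_dvd (by linarith) h.dvd
  omega

theorem t_apply_left {k : ℕ} {i j : ℤ} (hij : ¬ i ≡ j [ZMOD (k + 1)]) :
    (t k i j : Equiv.Perm ℤ) i = j := by
  simp [t_apply, swapFun, hij]

theorem t_apply_right {k : ℕ} {i j : ℤ} (hij : ¬ i ≡ j [ZMOD (k + 1)]) :
    (t k i j : Equiv.Perm ℤ) j = i := by
  have hij' : ¬ j ≡ i [ZMOD (k + 1)] := fun h => hij h.symm
  simp [t_apply, swapFun, hij, hij']

theorem t_apply_of_not_modEq {k : ℕ} {i j m : ℤ} (hi : ¬ m ≡ i [ZMOD (k + 1)])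
    (hj : ¬ m ≡ j [ZMOD (k + 1)]) : (t k i j : Equiv.Perm ℤ) m = m := by
  simp [t_apply, swapFun, hi, hj]

theorem coe_mul_apply {k : ℕ} (g h : W k) (m : ℤ) :
    ((g * h : W k) : Equiv.Perm ℤ) m = (g : Equiv.Perm ℤ) ((h : Equiv.Perm ℤ) m) := rfl

theorem t_congr {k : ℕ} {i j i' j' : ℤ} (h : i ≡ i' [ZMOD (k + 1)]) (hd : j - i = j' - i') :
    t k i j = t k i' j' := by
  have h' : j ≡ j' [ZMOD (k + 1)] := by
    have := h.add_right (j - i)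
    rw [show i + (j - i) = j by ring, hd, show i' + (j' - i') = j' by ring] at this
    exact this
  have e : ∀ m, (m ≡ i [ZMOD (k + 1)] ↔ m ≡ i' [ZMOD (k + 1)]) := fun m =>
    ⟨fun a => a.trans h, fun a => a.trans h.symm⟩
  have e' : ∀ m, (m ≡ j [ZMOD (k + 1)] ↔ m ≡ j' [ZMOD (k + 1)]) := fun m =>
    ⟨fun a => a.trans h', fun a => a.trans h'.symm⟩
  have e'' : (i ≡ j [ZMOD (k + 1)] ↔ i' ≡ j' [ZMOD (k + 1)]) := by
    exact ⟨fun a => (h.symm.trans a).trans h', fun a => (h.trans a).trans h'.symm⟩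
  apply Subtype.ext
  ext m
  change swapFun k i j m = swapFun k i' j' m
  simp only [swapFun, e'', hd, e, e']

theorem s_intCast (k : ℕ) (m : ℤ) : s k (m : ZMod (k + 1)) = t k m (m + 1) := by
  refine t_congr ?_ (by ring)
  rw [ZMod.val_intCast (n := k + 1) m]
  push_cast
  exact Int.mod_modEq _ _

theorem exists_intCast_eq {k : ℕ} (a : ZMod (k + 1)) : ∃ m : ℤ, (m : ZMod (k + 1)) = a :=
  ⟨a.val, by simp⟩

theorem s_mul_self {k : ℕ} (a : ZMod (k + 1)) : s k a * s k a = 1 := t_mul_self k _ _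

/-- A simple generator reverses the order of `p < q` only if it is the transposition of `p` and
`q = p + 1`. -/
theorem s_eq_t_of_apply_lt {k : ℕ} (a : ZMod (k + 1)) {p q : ℤ} (hpq : p < q)
    (h : (s k a : Equiv.Perm ℤ) q < (s k a : Equiv.Perm ℤ) p) : s k a = t k p q := by
  obtain ⟨b, rfl⟩ := exists_intCast_eq a
  rw [s_intCast] at h ⊢
  by_cases hb : b ≡ b + 1 [ZMOD (k + 1)]
  · simp only [t_apply, swapFun, if_pos hb] at h
    omega
  have hval : ∀ m, (t k b (b + 1) : Equiv.Perm ℤ) m =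
      if m ≡ b [ZMOD (k + 1)] then m + 1 else if m ≡ b + 1 [ZMOD (k + 1)] then m - 1 else m := by
    intro m
    simp [t_apply, swapFun, hb]
  rw [hval, hval] at h
  have hp : p ≡ b [ZMOD (k + 1)] := by
    by_contra hp
    simp only [if_neg hp] at h
    split_ifs at h <;> omega
  have hq : q = p + 1 := by
    rw [if_pos hp] at h
    have hpp : q ≠ p := by omega
    split_ifs at h with h1 h2 <;> omega
  subst hq
  exact t_congr hp.symm (by ring)

theorem not_modEq_of_apply_lt {k : ℕ} (x : W k) {i j : ℤ} (hij : i < j)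
    (h : (x : Equiv.Perm ℤ) j < (x : Equiv.Perm ℤ) i) : ¬ i ≡ j [ZMOD (k + 1)] := by
  intro hm
  have := apply_sub_modEq x hm
  omega

/-- The strong exchange property: if `t_{i,j}` is an inversion of `x`, then a word for
`x t_{i,j}` arises from any word for `x` by deleting one letter. -/
theorem exists_word_mul_t {k : ℕ} (a : List (ZMod (k + 1))) {i j : ℤ} (hij : i < j)
    (h : ((a.map (s k)).prod : Equiv.Perm ℤ) j < ((a.map (s k)).prod : Equiv.Perm ℤ) i) :
    ∃ b : List (ZMod (k + 1)), b.length + 1 = a.length ∧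
      (b.map (s k)).prod = (a.map (s k)).prod * t k i j := by
  induction a with
  | nil =>
    simp only [List.map_nil, List.prod_nil, OneMemClass.coe_one, Equiv.Perm.coe_one, id_eq] at h
    omega
  | cons c a ih =>
    have hm := not_modEq_of_apply_lt _ hij h
    simp only [List.map_cons, List.prod_cons] at h ⊢
    rcases lt_trichotomy (((a.map (s k)).prod : Equiv.Perm ℤ) i)
      (((a.map (s k)).prod : Equiv.Perm ℤ) j) with h1 | h1 | h1
    · refine ⟨a, rfl, ?_⟩
      rw [mul_assoc, mul_t_eq _ hm, ← s_eq_t_of_apply_lt c h1 h, ← mul_assoc, s_mul_self, one_mul]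
    · exact absurd (Equiv.injective _ h1) hij.ne
    · obtain ⟨b, hb, hb'⟩ := ih h1
      refine ⟨c :: b, by simpa using hb, ?_⟩
      simp only [List.map_cons, List.prod_cons, hb', mul_assoc]

theorem len_mul_t_lt {k : ℕ} (x : W k) {i j : ℤ} (hij : i < j)
    (h : (x : Equiv.Perm ℤ) j < (x : Equiv.Perm ℤ) i) : len (x * t k i j) < len x := by
  obtain ⟨a, ha, rfl⟩ := exists_reduced_word x
  obtain ⟨b, hb, hb'⟩ := exists_word_mul_t a hij h
  rw [← hb', ← ha, ← hb]
  exact Nat.lt_succ_of_le (len_le_of_word b)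

theorem mul_t_mul_t {k : ℕ} (x : W k) (i j : ℤ) : x * t k i j * t k i j = x := by
  rw [mul_assoc, t_mul_self, mul_one]

theorem lt_len_mul_t {k : ℕ} (x : W k) {i j : ℤ} (hij : i < j) (hm : ¬ i ≡ j [ZMOD (k + 1)])
    (h : (x : Equiv.Perm ℤ) i < (x : Equiv.Perm ℤ) j) : len x < len (x * t k i j) := by
  have := len_mul_t_lt (x * t k i j) hij (by
    rwa [coe_mul_apply, coe_mul_apply, t_apply_left hm, t_apply_right hm])
  rwa [mul_t_mul_t] at this

theorem len_mul_t_succ_le {k : ℕ} (x : W k) (i : ℤ) : len (x * t k i (i + 1)) ≤ len x + 1 := by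
  have h1 := len_le_of_word [(i : ZMod (k + 1))]
  have h2 := len_mul_le x (t k i (i + 1))
  simp only [List.map_cons, List.map_nil, List.prod_cons, List.prod_nil, mul_one,
      List.length_cons, List.length_nil, s_intCast] at h1
  omega

theorem le_len_mul_t_succ {k : ℕ} (x : W k) (i : ℤ) : len x ≤ len (x * t k i (i + 1)) + 1 := by
  have := len_mul_t_succ_le (x * t k i (i + 1)) i
  rwa [mul_t_mul_t] at this

theorem len_mul_t_succ_of_lt {k : ℕ} (hk : 1 ≤ k) (x : W k) (i : ℤ)
    (h : (x : Equiv.Perm ℤ) i < (x : Equiv.Perm ℤ) (i + 1)) :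
    len (x * t k i (i + 1)) = len x + 1 := by
  have h1 := len_mul_t_succ_le x i
  have h2 := lt_len_mul_t x (lt_add_one i) (not_modEq_of_lt (lt_add_one i) (by omega)) h
  omega

theorem len_mul_t_succ_of_gt {k : ℕ} (x : W k) (i : ℤ)
    (h : (x : Equiv.Perm ℤ) (i + 1) < (x : Equiv.Perm ℤ) i) :
    len (x * t k i (i + 1)) + 1 = len x := by
  have h1 := le_len_mul_t_succ x i
  have h2 := len_mul_t_lt x (lt_add_one i) h
  omega

/-- The value of `x t_{i,j}` on a window of `k + 1` integers containing `i` and `j`. -/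
theorem mul_t_apply {k : ℕ} (x : W k) {i j m : ℤ} (hij : i < j) (hjk : j - i ≤ k)
    (h1 : j - k ≤ m) (h2 : m ≤ i + k) :
    ((x * t k i j : W k) : Equiv.Perm ℤ) m =
      if m = i then (x : Equiv.Perm ℤ) j else if m = j then (x : Equiv.Perm ℤ) i
        else (x : Equiv.Perm ℤ) m := by
  have hm := not_modEq_of_lt hij hjk
  rw [coe_mul_apply]
  split_ifs with e1 e2
  · rw [e1, t_apply_left hm]
  · rw [e2, t_apply_right hm]
  · rw [t_apply_of_not_modEq]
    · rcases lt_or_gt_of_ne e1 with h | h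
      · exact not_modEq_of_lt h (by omega)
      · exact fun h' => not_modEq_of_lt h (by omega) h'.symm
    · rcases lt_or_gt_of_ne e2 with h | h
      · exact not_modEq_of_lt h (by omega)
      · exact fun h' => not_modEq_of_lt h (by omega) h'.symm

/-- An inversion with a value strictly in between is not a cover: `t_{i,j}` is then the product
`t_{i,m} t_{m,j} t_{i,m}`, and each of the three factors decreases the length. -/
theorem len_mul_t_of_between {k : ℕ} (x : W k) {i m j : ℤ} (him : i < m) (hmj : m < j)
    (hjk : j - i ≤ k) (h1 : (x : Equiv.Perm ℤ) j < (x : Equiv.Perm ℤ) m)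
    (h2 : (x : Equiv.Perm ℤ) m < (x : Equiv.Perm ℤ) i) : len (x * t k i j) + 3 ≤ len x := by
  have e : x * t k i j = x * t k i m * t k m j * t k i m := by
    have := mul_t_eq (t k i m) (not_modEq_of_lt hmj (by omega))
    rw [t_apply_right (not_modEq_of_lt him (by omega)), t_apply_of_not_modEq
      (fun h => not_modEq_of_lt (him.trans hmj) hjk h.symm)
      (fun h => not_modEq_of_lt hmj (by omega) h.symm)] at this
    rw [mul_assoc x, this, ← mul_assoc, mul_t_mul_t]
  have l1 := len_mul_t_lt x him h2
  have l2 := len_mul_t_lt (x * t k i m) hmj (by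
    rw [mul_t_apply _ him (by omega) (by omega) (by omega),
      mul_t_apply _ him (by omega) (by omega) (by omega)]
    split_ifs <;> omega)
  have l3 := len_mul_t_lt (x * t k i m * t k m j) him (by
    rw [mul_t_apply _ hmj (by omega) (by omega) (by omega),
      mul_t_apply _ hmj (by omega) (by omega) (by omega),
      mul_t_apply _ him (by omega) (by omega) (by omega),
      mul_t_apply _ him (by omega) (by omega) (by omega),
      mul_t_apply _ him (by omega) (by omega) (by omega)]
    split_ifs <;> omega)
  rw [e]
  omega

/-- An inversion with no value strictly in between is a cover. The proof is by induction on `j - i`: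
for `m = j - 1`, the reflection is the conjugate of `t_{i,m}` by the simple reflection `t_{m,j}`,
and the two factors `t_{m,j}` change the length in opposite directions. -/
theorem len_mul_t_of_not_between {k : ℕ} (x : W k) {i j : ℤ} (hij : i < j) (hjk : j - i ≤ k)
    (h : (x : Equiv.Perm ℤ) j < (x : Equiv.Perm ℤ) i)
    (hb : ∀ m, i < m → m < j →
      (x : Equiv.Perm ℤ) m < (x : Equiv.Perm ℤ) j ∨ (x : Equiv.Perm ℤ) i < (x : Equiv.Perm ℤ) m) :
    len (x * t k i j) + 1 = len x := by
  obtain ⟨d, rfl⟩ : ∃ d : ℕ, j = i + 1 + d := ⟨(j - i - 1).toNat, by omega⟩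
  induction d generalizing x with
  | zero =>
    simp only [Nat.cast_zero, add_zero] at h ⊢
    exact len_mul_t_succ_of_gt x i h
  | succ d ih =>
    push_cast at hij hjk h hb ⊢
    set m : ℤ := i + 1 + d with hm
    rw [show i + 1 + ((d : ℤ) + 1) = m + 1 by omega] at hij hjk h hb ⊢
    have hmi : i < m := by omega
    set x' := x * t k m (m + 1) with hx'
    have hv : ∀ p, i ≤ p → p ≤ m + 1 → (x' : Equiv.Perm ℤ) p =
        if p = m then (x : Equiv.Perm ℤ) (m + 1) else if p = m + 1 then (x : Equiv.Perm ℤ) m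
        else (x : Equiv.Perm ℤ) p := fun p hp1 hp2 =>
      mul_t_apply x (by omega) (by omega) (by omega) (by omega)
    have hvi := hv i le_rfl (by omega)
    have hvm := hv m (by omega) (by omega)
    have hvm' := hv (m + 1) (by omega) (by omega)
    rw [if_neg (by omega), if_neg (by omega)] at hvi
    rw [if_pos rfl] at hvm
    rw [if_neg (by omega), if_pos rfl] at hvm'
    have key := ih x' hmi (by omega) (by omega) (by
      intro p hp1 hp2
      rw [hv p (by omega) (by omega), if_neg (by omega), if_neg (by omega), hvm, hvi]
      exact hb p (by omega) (by omega))
    have e : x * t k i (m + 1) = x' * t k i m * t k m (m + 1) := by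
      have := mul_t_eq (t k m (m + 1)) (not_modEq_of_lt hmi (by omega))
      rw [t_apply_left (not_modEq_of_lt (lt_add_one m) (by omega)), t_apply_of_not_modEq
        (not_modEq_of_lt hmi (by omega)) (not_modEq_of_lt (by omega) (by omega))] at this
      rw [hx', mul_assoc x, this, ← mul_assoc, mul_t_mul_t]
    have f1 : ((x' * t k i m : W k) : Equiv.Perm ℤ) m = (x : Equiv.Perm ℤ) i := by
      rw [mul_t_apply _ (by omega) (by omega) (by omega) (by omega), if_neg (by omega),
        if_pos rfl, hvi]
    have f2 : ((x' * t k i m : W k) : Equiv.Perm ℤ) (m + 1) = (x : Equiv.Perm ℤ) m := by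
      rw [mul_t_apply _ (by omega) (by omega) (by omega) (by omega), if_neg (by omega),
        if_neg (by omega), hvm']
    have hk : 1 ≤ k := by omega
    rw [e]
    rcases hb m hmi (by omega) with h' | h'
    · have a1 : len x' = len x + 1 := len_mul_t_succ_of_lt hk x m h'
      have a2 := len_mul_t_succ_of_gt (x' * t k i m) m (by rw [f1, f2]; omega)
      omega
    · have a1 : len x' + 1 = len x := len_mul_t_succ_of_gt x m (by omega)
      have a2 := len_mul_t_succ_of_lt hk (x' * t k i m) m (by rw [f1, f2]; omega)
      omega

/-! ### The elements of `W` attached to sets of cells -/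

theorem readingWord_union (k : ℕ) {D E : Finset (ℕ × ℕ)}
    (h : ∀ x ∈ D, ∀ y ∈ E, y.1 < x.1 ∨ y.1 = x.1 ∧ y.2 < x.2) :
    readingWord k (D ∪ E) = readingWord k D ++ readingWord k E := by
  have hdisj : Disjoint D E := by
    rw [Finset.disjoint_left]
    intro x hx hy
    have := h x hx x hy
    omega
  have key : ((D ∪ E).map toLex.toEmbedding).sort (fun a b => a ≥ b)
      = (D.map toLex.toEmbedding).sort (fun a b => a ≥ b)
        ++ (E.map toLex.toEmbedding).sort (fun a b => a ≥ b) := by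
    refine List.Perm.eq_of_pairwise (le := fun a b => a ≥ b)
      (fun a b _ _ h1 h2 => le_antisymm h2 h1) (Finset.pairwise_sort _ _) ?_ ?_
    · rw [List.pairwise_append]
      refine ⟨Finset.pairwise_sort _ _, Finset.pairwise_sort _ _, fun a ha b hb => ?_⟩
      rw [Finset.mem_sort, Finset.mem_map] at ha hb
      obtain ⟨x, hx, rfl⟩ := ha
      obtain ⟨y, hy, rfl⟩ := hb
      exact (Prod.Lex.toLex_lt_toLex.2 (h x hx y hy)).le
    · rw [List.perm_ext_iff_of_nodup (Finset.sort_nodup _ _)]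
      · intro a
        simp only [Finset.mem_sort, List.mem_append, Finset.map_union, Finset.mem_union]
      · rw [List.nodup_append']
        refine ⟨Finset.sort_nodup _ _, Finset.sort_nodup _ _, ?_⟩
        intro a ha hb
        rw [Finset.mem_sort] at ha hb
        exact Finset.disjoint_left.1 ((Finset.disjoint_map _).2 hdisj) ha hb
  rw [readingWord, key, List.map_append]
  rfl

theorem wOf_union (k : ℕ) {D E : Finset (ℕ × ℕ)}
    (h : ∀ x ∈ D, ∀ y ∈ E, y.1 < x.1 ∨ y.1 = x.1 ∧ y.2 < x.2) :
    wOf k (D ∪ E) = wOf k D * wOf k E := by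
  rw [wOf, readingWord_union k h, List.map_append, List.prod_append]
  rfl

theorem wOf_singleton (k : ℕ) (x : ℕ × ℕ) :
    wOf k {x} = t k ((x.2 : ℤ) - x.1) ((x.2 : ℤ) - x.1 + 1) := by
  simp [wOf, readingWord, residue, ← s_intCast]

theorem wOf_empty (k : ℕ) : wOf k ∅ = 1 := by
  simp [wOf, readingWord]

theorem length_readingWord (k : ℕ) (D : Finset (ℕ × ℕ)) : (readingWord k D).length = D.card := by
  simp [readingWord]

theorem len_wOf_le (k : ℕ) (D : Finset (ℕ × ℕ)) : len (wOf k D) ≤ D.card := by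
  rw [← length_readingWord k D]
  exact len_le_of_word _

/-- If the reading word of `D` is reduced, then `u_D` is the basis element of `w_D`. -/
theorem uOf_eq_u {R : Type*} [CommRing R] {k : ℕ} {D : Finset (ℕ × ℕ)}
    (h : len (wOf k D) = D.card) : uOf R k D = u R (wOf k D) :=
  u_eq_prod_of_reduced _ (h.trans (length_readingWord k D).symm)

/-- Induction on a finite set of cells, adding them in the order in which they act. -/
theorem cells_induction {p : Finset (ℕ × ℕ) → Prop} (empty : p ∅)
    (insert : ∀ x D, (∀ y ∈ D, y.1 < x.1 ∨ y.1 = x.1 ∧ y.2 < x.2) → p D → p ({x} ∪ D))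
    (D : Finset (ℕ × ℕ)) : p D := by
  induction hn : D.card generalizing D with
  | zero => rwa [Finset.card_eq_zero.1 hn]
  | succ n ih =>
    obtain ⟨x, hx, hmax⟩ := Finset.exists_max_image D toLex (Finset.card_pos.1 (by omega))
    have h := insert x (D.erase x) (fun y hy => by
      rw [← Prod.Lex.toLex_lt_toLex]
      exact lt_of_le_of_ne (hmax y (Finset.mem_of_mem_erase hy))
        (fun h => Finset.ne_of_mem_erase hy (toLex.injective h)))
      (ih _ (by rw [Finset.card_erase_of_mem hx]; omega))
    rwa [← Finset.insert_eq, Finset.insert_erase hx] at h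

section Window

variable {k c : ℕ} {D : Finset (ℕ × ℕ)}

/-- A value of the window is fixed by the product over cells whose residues, read as integers,
do not touch it. -/
theorem wOf_apply_eq_self (hD : ∀ y ∈ D, y.1 + c ≤ k ∧ y.2 < c) {v : ℤ} (hv1 : (c : ℤ) - k ≤ v)
    (hv2 : v ≤ c) (h : ∀ y ∈ D, (y.2 : ℤ) - y.1 ≠ v ∧ (y.2 : ℤ) - y.1 + 1 ≠ v) :
    (wOf k D : Equiv.Perm ℤ) v = v := by
  induction D using cells_induction with
  | empty => simp [wOf_empty]
  | insert x D hx ih =>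
    have h1 := hD x (by simp)
    have h2 := h x (by simp)
    rw [wOf_union k (by simpa using hx), coe_mul_apply,
      ih (fun y hy => hD y (by simp [hy])) (fun y hy => h y (by simp [hy])), wOf_singleton]
    apply t_apply_of_not_modEq
    · rcases lt_or_gt_of_ne h2.1 with h' | h'
      · exact fun e => not_modEq_of_lt h' (by omega) e.symm
      · exact not_modEq_of_lt h' (by omega)
    · rcases lt_or_gt_of_ne h2.2 with h' | h'
      · exact fun e => not_modEq_of_lt h' (by omega) e.symm
      · exact not_modEq_of_lt h' (by omega)

/-- The elements `w_D` belong to the finite symmetric group of the window. -/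
theorem wOf_apply_mem_window (hD : ∀ y ∈ D, y.1 + c ≤ k ∧ y.2 < c) {v : ℤ}
    (hv1 : (c : ℤ) - k ≤ v) (hv2 : v ≤ c) :
    (c : ℤ) - k ≤ (wOf k D : Equiv.Perm ℤ) v ∧ (wOf k D : Equiv.Perm ℤ) v ≤ c := by
  induction D using cells_induction with
  | empty =>
    rw [wOf_empty]
    exact ⟨hv1, hv2⟩
  | insert x D hx ih =>
    have h1 := hD x (by simp)
    obtain ⟨h2, h3⟩ := ih (fun y hy => hD y (by simp [hy]))
    rw [wOf_union k (by simpa using hx), coe_mul_apply, wOf_singleton]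
    have h4 := mul_t_apply (k := k) 1 (i := (x.2 : ℤ) - x.1) (j := (x.2 : ℤ) - x.1 + 1)
      (m := (wOf k D : Equiv.Perm ℤ) v) (by omega) (by omega) (by omega) (by omega)
    rw [one_mul] at h4
    rw [h4]
    simp only [OneMemClass.coe_one, Equiv.Perm.coe_one, id_eq]
    split_ifs <;> omega

theorem wOf_apply_lt_window (hD : ∀ y ∈ D, y.1 + c ≤ k ∧ y.2 < c) {v : ℤ} :
    (wOf k D : Equiv.Perm ℤ) v < (c : ℤ) - k ↔ v < (c : ℤ) - k := by
  set a : ℤ := (c : ℤ) - k with ha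
  have hq : (0 : ℤ) < k + 1 := by positivity
  have h1 := Int.emod_nonneg (v - a) hq.ne'
  have h2 := Int.emod_lt_of_pos (v - a) hq
  obtain ⟨h3, h4⟩ := wOf_apply_mem_window hD (v := a + (v - a) % (k + 1)) (by omega) (by omega)
  have hmod : a + (v - a) % (k + 1) ≡ v [ZMOD (k + 1)] := by
    have := (Int.mod_modEq (v - a) (k + 1)).add_left a
    rwa [show a + (v - a) = v by ring] at this
  have e := apply_sub_modEq (wOf k D) hmod
  have h5 := Int.emod_add_mul_ediv (v - a) (k + 1)
  set q := (v - a) / (k + 1)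
  constructor
  · intro h
    have : q < 0 := by
      by_contra hq'
      have : 0 ≤ (k + 1) * q := mul_nonneg hq.le (by omega)
      omega
    have : (k + 1) * q ≤ (k + 1) * (-1) := mul_le_mul_of_nonneg_left (by omega) hq.le
    omega
  · intro h
    have : q < 0 := by
      by_contra hq'
      have : 0 ≤ (k + 1) * q := mul_nonneg hq.le (by omega)
      omega
    have : (k + 1) * q ≤ (k + 1) * (-1) := mul_le_mul_of_nonneg_left (by omega) hq.le
    omega

theorem window_lt_wOf_apply (hD : ∀ y ∈ D, y.1 + c ≤ k ∧ y.2 < c) {v : ℤ} :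
    c < (wOf k D : Equiv.Perm ℤ) v ↔ c < v := by
  have h := wOf_apply_lt_window hD (v := v - (k + 1))
  have e : (wOf k D : Equiv.Perm ℤ) (v - (k + 1)) = (wOf k D : Equiv.Perm ℤ) v - (k + 1) := by
    have := (wOf k D).2.1 (v - (k + 1))
    rw [sub_add_cancel] at this
    omega
  rw [e] at h
  omega

/-- The first `m` cells of row `r` carry the position `-r` to `m - r`. -/
theorem wOf_row (hD : ∀ y ∈ D, y.1 + c ≤ k ∧ y.2 < c) {r m : ℕ} (hr : r + c ≤ k) (hm : m ≤ c)
    (h1 : ∀ y ∈ D, y.1 = r ∧ y.2 < m) (h2 : ∀ j < m, (r, j) ∈ D) :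
    (wOf k D : Equiv.Perm ℤ) (-r) = m - r := by
  induction m generalizing D with
  | zero =>
    have : D = ∅ := Finset.eq_empty_of_forall_notMem fun y hy => by
      have := h1 y hy
      omega
    subst this
    simp [wOf_empty]
  | succ m ih =>
    have e : D = {(r, m)} ∪ {y ∈ D | y.2 < m} := by
      ext ⟨a, b⟩
      simp only [Finset.mem_union, Finset.mem_singleton, Finset.mem_filter, Prod.mk.injEq]
      constructor
      · intro h
        have := h1 _ h
        simp only at this
        by_cases hb : b < m
        · exact Or.inr ⟨h, hb⟩
        · exact Or.inl (by omega)
      · rintro (⟨rfl, rfl⟩ | ⟨h, -⟩)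
        · exact h2 _ (by omega)
        · exact h
    rw [e, wOf_union k, coe_mul_apply, ih, wOf_singleton]
    · push_cast
      rw [t_apply_left (not_modEq_of_lt (by omega) (by omega))]
      ring
    · exact fun y hy => hD y (Finset.mem_filter.1 hy).1
    · omega
    · intro y hy
      rw [Finset.mem_filter] at hy
      exact ⟨(h1 y hy.1).1, hy.2⟩
    · intro j hj
      exact Finset.mem_filter.2 ⟨h2 j (by omega), hj⟩
    · simp only [Finset.mem_singleton, Finset.mem_filter]
      rintro x rfl y ⟨hy, hy'⟩
      exact Or.inr ⟨(h1 y hy).1, hy'⟩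

/-- If the cells of `D` lie in the first `h` rows and include the first `h` cells of column `j`,
then only these `h` cells move the value that starts at the position `j + 1`. -/
theorem wOf_col (hD : ∀ y ∈ D, y.1 + c ≤ k ∧ y.2 < c) {j h : ℕ} (hj : j < c) (hh : h + c ≤ k + 1)
    (h1 : ∀ y ∈ D, y.1 < h) (h2 : ∀ i < h, (i, j) ∈ D) :
    (wOf k D : Equiv.Perm ℤ) (j + 1) = j + 1 - h := by
  induction h generalizing D with
  | zero =>
    have : D = ∅ := Finset.eq_empty_of_forall_notMem fun y hy => by
      have := h1 y hy
      omega
    subst this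
    simp [wOf_empty]
  | succ h ih =>
    have e : D = {y ∈ D | y.1 = h ∧ j < y.2} ∪ ({(h, j)} ∪ ({y ∈ D | y.1 = h ∧ y.2 < j}
        ∪ {y ∈ D | y.1 < h})) := by
      ext ⟨a, b⟩
      simp only [Finset.mem_union, Finset.mem_singleton, Finset.mem_filter, Prod.mk.injEq]
      constructor
      · intro h'
        have := h1 _ h'
        simp only at this
        simp only [h', true_and]
        omega
      · rintro (⟨h, -⟩ | ⟨rfl, rfl⟩ | ⟨h, -⟩ | ⟨h, -⟩)
        · exact h
        · exact h2 _ (by omega)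
        · exact h
        · exact h
    rw [e, wOf_union k, coe_mul_apply, wOf_union k, coe_mul_apply, wOf_union k, coe_mul_apply, ih,
      wOf_apply_eq_self (D := {y ∈ D | y.1 = h ∧ y.2 < j}) (c := c), wOf_singleton,
      show (j : ℤ) + 1 - h = j - h + 1 by ring,
      t_apply_right (not_modEq_of_lt (by omega) (by omega)), wOf_apply_eq_self (c := c)]
    · push_cast
      ring
    all_goals try simp only [Finset.mem_union, Finset.mem_singleton, Finset.mem_filter]
    · exact fun y hy => hD y hy.1
    · omega
    · omega
    · rintro y ⟨hy, rfl, hy'⟩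
      omega
    · exact fun y hy => hD y hy.1
    · omega
    · omega
    · rintro y ⟨hy, rfl, hy'⟩
      omega
    · exact fun y hy => hD y hy.1
    · omega
    · exact fun y hy => hy.2
    · exact fun i hi => ⟨h2 i (by omega), hi⟩
    · rintro x ⟨hx, hx'⟩ y ⟨hy, hy'⟩
      omega
    · rintro x rfl y (⟨hy, hy'⟩ | ⟨hy, hy'⟩) <;> grind
    · rintro x ⟨hx, hx'⟩ y (rfl | ⟨hy, hy'⟩ | ⟨hy, hy'⟩) <;> grind

/-- The cells which act before `x = (r, j)` carry the positions `-r` and `j + 1` to the two values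
that the generator of `x` interchanges, provided that the cells to the left of `x` and those above
`x` are present. -/
theorem wOf_initial (hD : ∀ y ∈ D, y.1 + c ≤ k ∧ y.2 < c) {r j : ℕ} (hr : r + c ≤ k) (hj : j < c)
    (h1 : ∀ y ∈ D, y.1 < r ∨ y.1 = r ∧ y.2 < j) (hleft : ∀ j' < j, (r, j') ∈ D)
    (hup : ∀ r' < r, (r', j) ∈ D) :
    (wOf k D : Equiv.Perm ℤ) (-r) = j - r ∧ (wOf k D : Equiv.Perm ℤ) (j + 1) = j - r + 1 := by
  have e : D = {y ∈ D | y.1 = r ∧ y.2 < j} ∪ {y ∈ D | y.1 < r} := by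
    ext y
    simp only [Finset.mem_union, Finset.mem_filter]
    constructor
    · intro hy
      rcases h1 y hy with h | h
      · exact Or.inr ⟨hy, h⟩
      · exact Or.inl ⟨hy, h⟩
    · rintro (h | h) <;> exact h.1
  have hu : wOf k D = wOf k {y ∈ D | y.1 = r ∧ y.2 < j} * wOf k {y ∈ D | y.1 < r} := by
    conv_lhs => rw [e]
    refine wOf_union k ?_
    simp only [Finset.mem_filter]
    rintro x ⟨-, hx⟩ y ⟨-, hy⟩
    omega
  have hA : ∀ y ∈ {y ∈ D | y.1 = r ∧ y.2 < j}, y.1 + c ≤ k ∧ y.2 < c :=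
    fun y hy => hD y (Finset.mem_filter.1 hy).1
  have hB : ∀ y ∈ {y ∈ D | y.1 < r}, y.1 + c ≤ k ∧ y.2 < c :=
    fun y hy => hD y (Finset.mem_filter.1 hy).1
  constructor
  · rw [hu, coe_mul_apply, wOf_apply_eq_self hB (by omega) (by omega) (fun y hy => by
      have := (Finset.mem_filter.1 hy).2
      omega)]
    exact wOf_row hA hr hj.le (fun y hy => (Finset.mem_filter.1 hy).2)
      fun i hi => Finset.mem_filter.2 ⟨hleft i hi, rfl, hi⟩
  · rw [hu, coe_mul_apply, wOf_col hB hj (h := r) (by omega)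
      (fun y hy => (Finset.mem_filter.1 hy).2) fun i hi => Finset.mem_filter.2 ⟨hup i hi, hi⟩]
    rw [wOf_apply_eq_self hA (by omega) (by omega) (fun y hy => by
      have := (Finset.mem_filter.1 hy).2
      omega)]
    ring

/-- The reflection `t_{-r,j+1}` that belongs to the cell `(r, j)`: the position of row `r` is `-r`
and the position of column `j` is `j + 1`. -/
def cellRefl (k : ℕ) (x : ℕ × ℕ) : W k := t k (-(x.1 : ℤ)) (x.2 + 1)

theorem wOf_insert_initial (hD : ∀ y ∈ D, y.1 + c ≤ k ∧ y.2 < c) {x : ℕ × ℕ} (hr : x.1 + c ≤ k)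
    (hj : x.2 < c) (h1 : ∀ y ∈ D, y.1 < x.1 ∨ y.1 = x.1 ∧ y.2 < x.2)
    (hleft : ∀ j' < x.2, (x.1, j') ∈ D) (hup : ∀ r' < x.1, (r', x.2) ∈ D) :
    wOf k ({x} ∪ D) = wOf k D * cellRefl k x := by
  obtain ⟨e1, e2⟩ := wOf_initial hD hr hj h1 hleft hup
  rw [wOf_union k (by simpa using h1), cellRefl, mul_t_eq _ (not_modEq_of_lt (by omega) (by omega)),
    e1, e2, wOf_singleton]

/-- Deleting a cell `x` of `D` multiplies `w_D` on the right by the reflection of `x`, provided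
that `D` contains the cells to the left of `x` and those above `x`. -/
theorem wOf_erase (hD : ∀ y ∈ D, y.1 + c ≤ k ∧ y.2 < c) {x : ℕ × ℕ} (hx : x ∈ D)
    (hleft : ∀ j' < x.2, (x.1, j') ∈ D) (hup : ∀ r' < x.1, (r', x.2) ∈ D) :
    wOf k (D.erase x) = wOf k D * cellRefl k x := by
  set A := {y ∈ D | x.1 < y.1 ∨ x.1 = y.1 ∧ x.2 < y.2} with hA
  set B := {y ∈ D | y.1 < x.1 ∨ y.1 = x.1 ∧ y.2 < x.2} with hB
  have e1 : D = A ∪ ({x} ∪ B) := by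
    ext ⟨a, b⟩
    obtain ⟨r, j⟩ := x
    simp only [hA, hB, Finset.mem_union, Finset.mem_singleton, Finset.mem_filter, Prod.mk.injEq]
    constructor
    · intro h
      simp only [h, true_and]
      omega
    · rintro (⟨h, -⟩ | ⟨rfl, rfl⟩ | ⟨h, -⟩) <;> assumption
  have e2 : D.erase x = A ∪ B := by
    ext ⟨a, b⟩
    obtain ⟨r, j⟩ := x
    simp only [hA, hB, Finset.mem_union, Finset.mem_erase, Finset.mem_filter, ne_eq, Prod.mk.injEq]
    constructor
    · rintro ⟨h, h'⟩
      simp only [h', true_and]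
      omega
    · rintro (⟨h, h'⟩ | ⟨h, h'⟩)
      · exact ⟨by omega, h⟩
      · exact ⟨by omega, h⟩
  have h3 : wOf k ({x} ∪ B) = wOf k B * cellRefl k x := by
    obtain ⟨h4, h5⟩ := hD x hx
    apply wOf_insert_initial (c := c) _ h4 h5
    all_goals try simp only [hB, Finset.mem_filter]
    · exact fun y hy => hy.2
    · exact fun j hj => ⟨hleft j hj, by simpa using hj⟩
    · exact fun r hr => ⟨hup r hr, by simpa using hr⟩
    · exact fun y hy => hD y hy.1
  have h6 : wOf k D = wOf k A * (wOf k B * cellRefl k x) := by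
    rw [← h3]
    conv_lhs => rw [e1]
    refine wOf_union k ?_
    simp only [hA, hB, Finset.mem_union, Finset.mem_singleton, Finset.mem_filter]
    rintro y ⟨-, hy⟩ z (rfl | ⟨-, hz⟩) <;> omega
  have h7 : wOf k (D.erase x) = wOf k A * wOf k B := by
    rw [e2]
    refine wOf_union k ?_
    simp only [hA, hB, Finset.mem_filter]
    rintro y ⟨-, hy⟩ z ⟨-, hz⟩
    omega
  rw [h6, h7, ← mul_assoc, cellRefl, mul_t_mul_t]

/-- The reading word of a Young diagram in the rectangle is reduced. -/
theorem len_wOf_of_isLowerSet (hD : ∀ y ∈ D, y.1 + c ≤ k ∧ y.2 < c)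
    (hl : IsLowerSet (D : Set (ℕ × ℕ))) : len (wOf k D) = D.card := by
  refine le_antisymm (len_wOf_le k D) ?_
  induction D using cells_induction with
  | empty => simp
  | insert x D hx ih =>
    have hx' : x ∉ D := fun h => by
      have := hx x h
      omega
    have hmem : ∀ y ≤ x, y ≠ x → y ∈ D := by
      intro y hy hne
      have : y ∈ ((({x} ∪ D : Finset (ℕ × ℕ))) : Set (ℕ × ℕ)) := hl hy (by simp)
      simpa [hne] using this
    have hl' : IsLowerSet (D : Set (ℕ × ℕ)) := by
      intro y z hzy hy
      have : z ∈ ((({x} ∪ D : Finset (ℕ × ℕ))) : Set (ℕ × ℕ)) :=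
        hl hzy (by simp [Finset.mem_coe.1 hy])
      simp only [Finset.coe_union, Finset.coe_singleton, Set.mem_union, Set.mem_singleton_iff,
        Finset.mem_coe] at this
      rcases this with rfl | h
      · have h1 := hx y hy
        have h2 := hzy.1
        have h3 := hzy.2
        omega
      · exact h
    have hD' : ∀ y ∈ D, y.1 + c ≤ k ∧ y.2 < c := fun y hy => hD y (by simp [hy])
    obtain ⟨h1, h2⟩ := hD x (by simp)
    have hleft : ∀ j' < x.2, (x.1, j') ∈ D := fun j hj =>
      hmem _ ⟨le_rfl, hj.le⟩ fun h => by rw [← h] at hj; simp at hj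
    have hup : ∀ r' < x.1, (r', x.2) ∈ D := fun r hr =>
      hmem _ ⟨hr.le, le_rfl⟩ fun h => by rw [← h] at hr; simp at hr
    obtain ⟨e1, e2⟩ := wOf_initial hD' h1 h2 hx hleft hup
    have h3 := ih hD' hl'
    rw [wOf_insert_initial hD' h1 h2 hx hleft hup, ← Finset.insert_eq,
      Finset.card_insert_of_notMem hx', cellRefl]
    have := lt_len_mul_t (wOf k D) (i := -(x.1 : ℤ)) (j := x.2 + 1) (by omega)
      (not_modEq_of_lt (by omega) (by omega)) (by rw [e1, e2]; omega)
    omega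

end Window

/-! ### Values and labels -/

/-- The value of `w_μ` at the position `-r` of row `r`. -/
def rowEnd (μ : YoungDiagram) (r : ℕ) : ℤ := μ.rowLen r - r

/-- The value of `w_μ` at the position `j + 1` of column `j`. -/
def colEnd (μ : YoungDiagram) (j : ℕ) : ℤ := j + 1 - μ.colLen j

/-- The least of `rowEnd μ r` and of the values `colEnd μ j'` over the cells `(r, j')` of `Y` with
`j ≤ j'`. For `j = 0` this is the value of `w_{μ \ Y}` at the position of row `r`, and, if `(r, j)`
is a cell of `Y`, then for `j + 1` it is the value of `w_{μ \ Y}` at the position of column `j`. -/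
def wireVal (μ : YoungDiagram) (Y : Finset (ℕ × ℕ)) (r j : ℕ) : ℤ :=
  {y ∈ Y | y.1 = r ∧ j ≤ y.2}.fold min (rowEnd μ r) fun y => colEnd μ y.2

/-- The label of a cell of `Y`: the label of the edge of a strong strip that deletes this cell, if
`Y` is the set of all cells which the strip deletes. -/
def label (μ : YoungDiagram) (Y : Finset (ℕ × ℕ)) (y : ℕ × ℕ) : ℤ := wireVal μ Y y.1 (y.2 + 1)

section Combinatorics

variable {μ : YoungDiagram} {X Y : Finset (ℕ × ℕ)}

theorem rowEnd_strictAnti (μ : YoungDiagram) : StrictAnti (rowEnd μ) := by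
  intro a b h
  have := μ.rowLen_anti _ _ h.le
  simp only [rowEnd]
  omega

theorem colEnd_strictMono (μ : YoungDiagram) : StrictMono (colEnd μ) := by
  intro a b h
  have := μ.colLen_anti _ _ h.le
  simp only [colEnd]
  omega

theorem colEnd_lt_rowEnd_iff {x : ℕ × ℕ} : colEnd μ x.2 < rowEnd μ x.1 ↔ x ∈ μ := by
  have h1 : x ∈ μ ↔ x.2 < μ.rowLen x.1 := YoungDiagram.mem_iff_lt_rowLen
  have h2 : x ∈ μ ↔ x.1 < μ.colLen x.2 := YoungDiagram.mem_iff_lt_colLen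
  simp only [colEnd, rowEnd]
  by_cases h : x ∈ μ
  · have := h1.1 h
    have := h2.1 h
    simp only [h, iff_true]
    omega
  · have := mt h1.2 h
    have := mt h2.2 h
    simp only [h, iff_false]
    omega

theorem rowEnd_lt_colEnd {x : ℕ × ℕ} (h : x ∉ μ) : rowEnd μ x.1 < colEnd μ x.2 := by
  have h1 : ¬ x.2 < μ.rowLen x.1 := mt YoungDiagram.mem_iff_lt_rowLen.2 h
  have h2 : ¬ x.1 < μ.colLen x.2 := mt YoungDiagram.mem_iff_lt_colLen.2 h
  simp only [colEnd, rowEnd]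
  omega

theorem wireVal_le_rowEnd (μ : YoungDiagram) (Y : Finset (ℕ × ℕ)) (r j : ℕ) :
    wireVal μ Y r j ≤ rowEnd μ r :=
  (Finset.fold_min_le _).2 (Or.inl le_rfl)

theorem wireVal_le_colEnd {y : ℕ × ℕ} (hy : y ∈ Y) {j : ℕ} (hj : j ≤ y.2) :
    wireVal μ Y y.1 j ≤ colEnd μ y.2 :=
  (Finset.fold_min_le _).2 (Or.inr ⟨y, Finset.mem_filter.2 ⟨hy, rfl, hj⟩, le_rfl⟩)

theorem lt_wireVal_iff {r j : ℕ} {v : ℤ} : v < wireVal μ Y r j ↔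
    v < rowEnd μ r ∧ ∀ y ∈ Y, y.1 = r → j ≤ y.2 → v < colEnd μ y.2 := by
  simp only [wireVal, Finset.lt_fold_min, Finset.mem_filter, and_imp]

theorem wireVal_eq (μ : YoungDiagram) (Y : Finset (ℕ × ℕ)) (r j : ℕ) :
    wireVal μ Y r j = rowEnd μ r ∨ ∃ y ∈ Y, y.1 = r ∧ j ≤ y.2 ∧ wireVal μ Y r j = colEnd μ y.2 := by
  rcases (Finset.fold_min_le _).1 (le_refl (wireVal μ Y r j)) with h | ⟨y, hy, h⟩
  · exact Or.inl (le_antisymm (wireVal_le_rowEnd μ Y r j) h)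
  · obtain ⟨h1, rfl, h3⟩ := Finset.mem_filter.1 hy
    exact Or.inr ⟨y, h1, rfl, h3, le_antisymm (wireVal_le_colEnd h1 h3) h⟩

theorem wireVal_congr {r j j' : ℕ}
    (h : ∀ y, y.1 = r → (y ∈ X ∧ j ≤ y.2 ↔ y ∈ Y ∧ j' ≤ y.2)) :
    wireVal μ X r j = wireVal μ Y r j' := by
  rw [wireVal, wireVal]
  congr 1
  ext y
  have := h y
  simp only [Finset.mem_filter]
  tauto

theorem wireVal_insert_of_ne {x : ℕ × ℕ} {r j : ℕ} (h : x.1 ≠ r) :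
    wireVal μ (insert x Y) r j = wireVal μ Y r j := by
  refine wireVal_congr fun y hy => ?_
  have : y ≠ x := fun e => h (e ▸ hy)
  simp [this]

theorem wireVal_insert_of_lt {x : ℕ × ℕ} {r j : ℕ} (h : x.2 < j) :
    wireVal μ (insert x Y) r j = wireVal μ Y r j := by
  refine wireVal_congr fun y hy => ?_
  by_cases e : y = x
  · subst e
    simp [h]
  · simp [e]

theorem wireVal_insert_zero {x : ℕ × ℕ} (h : colEnd μ x.2 ≤ wireVal μ Y x.1 0) :
    wireVal μ (insert x Y) x.1 0 = colEnd μ x.2 := by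
  refine le_antisymm (wireVal_le_colEnd (by simp) (by simp)) ?_
  rw [wireVal, Finset.le_fold_min]
  refine ⟨h.trans (wireVal_le_rowEnd _ _ _ _), fun y hy => ?_⟩
  obtain ⟨h1, h2, -⟩ := Finset.mem_filter.1 hy
  rcases Finset.mem_insert.1 h1 with rfl | h1
  · exact le_rfl
  · exact h.trans (h2 ▸ wireVal_le_colEnd h1 (Nat.zero_le _))

theorem colEnd_lt_label {y : ℕ × ℕ} (hy : y ∈ μ) : colEnd μ y.2 < label μ Y y :=
  lt_wireVal_iff.2 ⟨colEnd_lt_rowEnd_iff.2 hy, fun _ _ _ h => colEnd_strictMono μ h⟩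

theorem label_lt_label {y z : ℕ × ℕ} (hz : z ∈ μ) (hzY : z ∈ Y) (hr : y.1 = z.1) (h : y.2 < z.2) :
    label μ Y y < label μ Y z := by
  refine lt_of_le_of_lt ?_ (colEnd_lt_label hz)
  rw [label, hr]
  exact wireVal_le_colEnd hzY h

/-- The labels of the cells of a set with at most one cell in each column are distinct. -/
theorem label_injOn (hX : X ⊆ μ.cells) (h1 : C1 X) : Set.InjOn (label μ X) X := by
  have hsub : ∀ y ∈ X, y ∈ μ := fun y hy => (YoungDiagram.mem_cells _).1 (hX hy)
  -- equal labels force the two cells into the same row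
  have hrow : ∀ y ∈ X, ∀ z ∈ X, label μ X y = label μ X z → y.1 = z.1 := by
    intro y hy z hz h
    have hne : ∀ r j, rowEnd μ r ≠ colEnd μ j := by
      intro r j h
      by_cases hm : (r, j) ∈ μ
      · exact (colEnd_lt_rowEnd_iff.2 hm).ne' h
      · exact (rowEnd_lt_colEnd hm).ne h
    rcases wireVal_eq μ X y.1 (y.2 + 1) with e | ⟨y', hy', e1, e2, e⟩ <;>
      rcases wireVal_eq μ X z.1 (z.2 + 1) with f | ⟨z', hz', f1, f2, f⟩ <;>
      simp only [label, e, f] at h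
    · exact (rowEnd_strictAnti μ).injective h
    · exact absurd h (hne _ _)
    · exact absurd h.symm (hne _ _)
    · have h' := (colEnd_strictMono μ).injective h
      by_cases heq : y' = z'
      · rw [← e1, ← f1, heq]
      · exact absurd h' (h1 _ hy' _ hz' heq)
  intro y hy z hz h
  have hr := hrow y hy z hz h
  rcases lt_trichotomy y.2 z.2 with hc | hc | hc
  · exact absurd h (label_lt_label (hsub z hz) hz hr hc).ne
  · exact Prod.ext hr hc
  · exact absurd h (label_lt_label (hsub y hy) hy hr.symm hc).ne'

end Combinatorics

/-! ### The values of the elements along a strip -/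

section Wires

variable {k c : ℕ} {μ : YoungDiagram} {X Y : Finset (ℕ × ℕ)}

theorem mem_rect_of_le (hc : c ≤ k) (hμ : μ ≤ kRectangle k c) {y : ℕ × ℕ} (hy : y ∈ μ) :
    y.1 + c ≤ k ∧ y.2 < c := by
  have h : y ∈ (kRectangle k c).cells := hμ hy
  simp only [kRectangle, Finset.mem_product, Finset.mem_range] at h
  omega

theorem wOf_diagram_row (hμ : ∀ y ∈ μ, y.1 + c ≤ k ∧ y.2 < c) {r : ℕ} (hr : r + c ≤ k) :
    (wOf k μ.cells : Equiv.Perm ℤ) (-r) = rowEnd μ r := by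
  have hD : ∀ y ∈ μ.cells, y.1 + c ≤ k ∧ y.2 < c :=
    fun y hy => hμ y ((YoungDiagram.mem_cells _).1 hy)
  have hmem : ∀ y : ℕ × ℕ, y ∈ μ.cells ↔ y.2 < μ.rowLen y.1 := fun y =>
    (YoungDiagram.mem_cells _).trans YoungDiagram.mem_iff_lt_rowLen
  have hlen : μ.rowLen r ≤ c := by
    by_contra h
    have := hμ (r, c) (YoungDiagram.mem_iff_lt_rowLen.2 (by omega))
    omega
  have e : μ.cells = {y ∈ μ.cells | r < y.1} ∪
      ({y ∈ μ.cells | y.1 = r} ∪ {y ∈ μ.cells | y.1 < r}) := by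
    ext y
    simp only [Finset.mem_union, Finset.mem_filter]
    have := lt_trichotomy r y.1
    tauto
  have hf : ∀ p : ℕ × ℕ → Prop, [DecidablePred p] →
      ∀ y ∈ {y ∈ μ.cells | p y}, y.1 + c ≤ k ∧ y.2 < c :=
    fun p _ y hy => hD y (Finset.mem_filter.1 hy).1
  have hu : wOf k μ.cells = wOf k {y ∈ μ.cells | r < y.1} *
      (wOf k {y ∈ μ.cells | y.1 = r} * wOf k {y ∈ μ.cells | y.1 < r}) := by
    rw [← wOf_union, ← wOf_union, ← e]
    · simp only [Finset.mem_union, Finset.mem_filter]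
      omega
    · simp only [Finset.mem_filter]
      omega
  rw [hu, coe_mul_apply, coe_mul_apply,
    wOf_apply_eq_self (hf fun y => y.1 < r) (by omega) (by omega) (fun y hy => by
      have h2 := (Finset.mem_filter.1 hy).2
      omega),
    wOf_row (hf fun y => y.1 = r) hr hlen
      (fun y hy => by
        obtain ⟨h1, h2⟩ := Finset.mem_filter.1 hy
        exact ⟨h2, h2 ▸ (hmem y).1 h1⟩)
      (fun j hj => Finset.mem_filter.2 ⟨(hmem _).2 hj, rfl⟩),
    wOf_apply_eq_self (hf fun y => r < y.1) (by omega) (by omega) (fun y hy => by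
      obtain ⟨h1, h2⟩ := Finset.mem_filter.1 hy
      have h3 := (hmem y).1 h1
      have h4 := μ.rowLen_anti _ _ h2.le
      omega), rowEnd]

theorem wOf_diagram_col (hμ : ∀ y ∈ μ, y.1 + c ≤ k ∧ y.2 < c) (hc : c ≤ k) {j : ℕ} (hj : j < c) :
    (wOf k μ.cells : Equiv.Perm ℤ) (j + 1) = colEnd μ j := by
  have hD : ∀ y ∈ μ.cells, y.1 + c ≤ k ∧ y.2 < c :=
    fun y hy => hμ y ((YoungDiagram.mem_cells _).1 hy)
  have hmem : ∀ y : ℕ × ℕ, y ∈ μ.cells ↔ y.1 < μ.colLen y.2 := fun y =>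
    (YoungDiagram.mem_cells _).trans YoungDiagram.mem_iff_lt_colLen
  set h := μ.colLen j with hh
  have hlen : h + c ≤ k + 1 := by
    by_contra h'
    have := hμ (h - 1, j) (YoungDiagram.mem_iff_lt_colLen.2 (by omega))
    omega
  have e : μ.cells = {y ∈ μ.cells | h ≤ y.1} ∪ {y ∈ μ.cells | y.1 < h} := by
    ext y
    simp only [Finset.mem_union, Finset.mem_filter]
    have := le_or_gt h y.1
    tauto
  have hf : ∀ p : ℕ × ℕ → Prop, [DecidablePred p] →
      ∀ y ∈ {y ∈ μ.cells | p y}, y.1 + c ≤ k ∧ y.2 < c :=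
    fun p _ y hy => hD y (Finset.mem_filter.1 hy).1
  have hu : wOf k μ.cells = wOf k {y ∈ μ.cells | h ≤ y.1} * wOf k {y ∈ μ.cells | y.1 < h} := by
    rw [← wOf_union, ← e]
    simp only [Finset.mem_filter]
    omega
  rw [hu, coe_mul_apply, wOf_col (hf _) hj hlen, wOf_apply_eq_self (hf _) (by omega) (by omega),
    colEnd]
  · intro y hy
    obtain ⟨h1, h2⟩ := Finset.mem_filter.1 hy
    have h3 : y.2 < j := by
      by_contra h'
      have h4 := (hmem y).1 h1
      have h5 := μ.colLen_anti _ _ (not_lt.1 h')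
      omega
    omega
  · exact fun y hy => (Finset.mem_filter.1 hy).2
  · exact fun i hi => Finset.mem_filter.2 ⟨(hmem _).2 hi, hi⟩

/-- `w_{μ \ Y}` takes the values predicted by `wireVal` on the window. -/
structure HasWires (k c : ℕ) (μ : YoungDiagram) (Y : Finset (ℕ × ℕ)) : Prop where
  row : ∀ r, r + c ≤ k → (wOf k (μ.cells \ Y) : Equiv.Perm ℤ) (-r) = wireVal μ Y r 0
  col_free : ∀ j < c, (∀ y ∈ Y, y.2 ≠ j) →
    (wOf k (μ.cells \ Y) : Equiv.Perm ℤ) (j + 1) = colEnd μ j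
  col_used : ∀ y ∈ Y, (wOf k (μ.cells \ Y) : Equiv.Perm ℤ) (y.2 + 1) = label μ Y y

theorem HasWires.empty (hμ : ∀ y ∈ μ, y.1 + c ≤ k ∧ y.2 < c) (hc : c ≤ k) :
    HasWires k c μ ∅ := by
  refine ⟨fun r hr => ?_, fun j hj _ => ?_, by simp⟩
  · rw [Finset.sdiff_empty, wOf_diagram_row hμ hr]
    rfl
  · rw [Finset.sdiff_empty, wOf_diagram_col hμ hc hj]

/-- The cell `x` may be deleted after the cells of `Y`: no cell of `Y` lies in its column or to its
left in its row. -/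
def Deletable (Y : Finset (ℕ × ℕ)) (x : ℕ × ℕ) : Prop :=
  (∀ y ∈ Y, y.2 ≠ x.2) ∧ ∀ y ∈ Y, y.1 = x.1 → x.2 < y.2

theorem Deletable.notMem {x : ℕ × ℕ} (h : Deletable Y x) : x ∉ Y := fun hx => h.1 x hx rfl

theorem wOf_sdiff_insert (hμ : ∀ y ∈ μ, y.1 + c ≤ k ∧ y.2 < c) {x : ℕ × ℕ} (hx : x ∈ μ)
    (h : Deletable Y x) :
    wOf k (μ.cells \ insert x Y) = wOf k (μ.cells \ Y) * cellRefl k x := by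
  have hD : ∀ y ∈ μ.cells \ Y, y.1 + c ≤ k ∧ y.2 < c :=
    fun y hy => hμ y ((YoungDiagram.mem_cells _).1 (Finset.mem_sdiff.1 hy).1)
  rw [← wOf_erase hD, Finset.sdiff_insert]
  · exact Finset.mem_sdiff.2 ⟨(YoungDiagram.mem_cells _).2 hx, h.notMem⟩
  · intro j hj
    refine Finset.mem_sdiff.2 ⟨(YoungDiagram.mem_cells _).2 (μ.up_left_mem le_rfl hj.le hx),
      fun hy => ?_⟩
    have := h.2 _ hy rfl
    simp only at this
    omega
  · intro r hr
    exact Finset.mem_sdiff.2 ⟨(YoungDiagram.mem_cells _).2 (μ.up_left_mem hr.le le_rfl hx),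
      fun hy => h.1 _ hy rfl⟩

theorem colEnd_lt_wireVal {x : ℕ × ℕ} (hx : x ∈ μ) (h : Deletable Y x) :
    colEnd μ x.2 < wireVal μ Y x.1 0 :=
  lt_wireVal_iff.2 ⟨colEnd_lt_rowEnd_iff.2 hx, fun y hy hr _ => colEnd_strictMono μ (h.2 y hy hr)⟩

theorem label_insert_self {x : ℕ × ℕ} (h : Deletable Y x) :
    label μ (insert x Y) x = wireVal μ Y x.1 0 := by
  refine wireVal_congr fun y hy => ?_
  rw [Finset.mem_insert]
  constructor
  · rintro ⟨rfl | h1, h2⟩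
    · omega
    · exact ⟨h1, Nat.zero_le _⟩
  · rintro ⟨h1, -⟩
    exact ⟨Or.inr h1, h.2 y h1 hy⟩

theorem label_insert_of_mem {x y : ℕ × ℕ} (h : Deletable Y x) (hy : y ∈ Y) :
    label μ (insert x Y) y = label μ Y y := by
  by_cases hr : x.1 = y.1
  · have := h.2 y hy hr.symm
    exact wireVal_insert_of_lt (by omega)
  · exact wireVal_insert_of_ne hr

/-- On the window, multiplying by the reflection of `x = (r, j)` interchanges the values at the
positions of row `r` and column `j`. -/
theorem HasWires.insert_cell (hμ : ∀ y ∈ μ, y.1 + c ≤ k ∧ y.2 < c) (hY : Y ⊆ μ.cells)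
    (hw : HasWires k c μ Y) {x : ℕ × ℕ} (hx : x ∈ μ) (h : Deletable Y x) :
    HasWires k c μ (insert x Y) := by
  obtain ⟨h1, h2⟩ := hμ x hx
  have hv : ∀ m : ℤ, (c : ℤ) - k ≤ m → m ≤ c →
      (wOf k (μ.cells \ insert x Y) : Equiv.Perm ℤ) m =
        if m = -x.1 then (wOf k (μ.cells \ Y) : Equiv.Perm ℤ) (x.2 + 1)
        else if m = x.2 + 1 then (wOf k (μ.cells \ Y) : Equiv.Perm ℤ) (-x.1)
        else (wOf k (μ.cells \ Y) : Equiv.Perm ℤ) m := by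
    intro m hm1 hm2
    rw [wOf_sdiff_insert hμ hx h, cellRefl,
      mul_t_apply _ (by omega) (by omega) (by omega) (by omega)]
  refine ⟨fun r hr => ?_, fun j hj hfree => ?_, fun y hy => ?_⟩
  · rw [hv (-(r : ℤ)) (by omega) (by omega)]
    by_cases e : r = x.1
    · subst e
      rw [if_pos rfl, hw.col_free _ h2 h.1, wireVal_insert_zero (colEnd_lt_wireVal hx h).le]
    · rw [if_neg (by omega), if_neg (by omega), hw.row r hr, wireVal_insert_of_ne (Ne.symm e)]
  · have e := hfree x (by simp)
    rw [hv ((j : ℤ) + 1) (by omega) (by omega), if_neg (by omega), if_neg (by omega),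
      hw.col_free j hj fun y hy => hfree y (by simp [hy])]
  · rcases Finset.mem_insert.1 hy with rfl | hy
    · rw [hv ((y.2 : ℤ) + 1) (by omega) (by omega), if_neg (by omega), if_pos rfl, hw.row _ h1,
        label_insert_self h]
    · have h3 := hμ y ((YoungDiagram.mem_cells _).1 (hY hy))
      have e := h.1 y hy
      rw [hv ((y.2 : ℤ) + 1) (by omega) (by omega), if_neg (by omega), if_neg (by omega),
        hw.col_used y hy,
        label_insert_of_mem h hy]

end Wires

/-! ### Strong covers below a diagram with deleted cells -/

section Edges

variable {k c : ℕ} {μ : YoungDiagram} {D X Y : Finset (ℕ × ℕ)}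

theorem IsEdge.not_modEq {x y : W k} {i j : ℤ} (h : IsEdge x y i j) : ¬ i ≡ j [ZMOD (k + 1)] := by
  intro hm
  obtain ⟨-, -, ht, hl⟩ := h
  have h1 : t k i j = 1 := by
    apply Subtype.ext
    ext m
    simp [t_apply, swapFun, hm]
  rw [h1, mul_one] at ht
  rw [ht] at hl
  omega

/-- The edges of the marked strong order graph that begin at `w_D`, for a set `D` of cells of the
rectangle: they belong to a row and a column, and remove an inversion which is a cover. -/
theorem isEdge_wOf_iff (hD : ∀ y ∈ D, y.1 + c ≤ k ∧ y.2 < c) {y : W k} {i j : ℤ} :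
    IsEdge (wOf k D) y i j ↔ (y = wOf k D * t k i j ∧ (c : ℤ) - k ≤ i ∧ i ≤ 0 ∧ 0 < j ∧ j ≤ c ∧
      (wOf k D : Equiv.Perm ℤ) j < (wOf k D : Equiv.Perm ℤ) i ∧
      ∀ m, i < m → m < j → (wOf k D : Equiv.Perm ℤ) m < (wOf k D : Equiv.Perm ℤ) j ∨
        (wOf k D : Equiv.Perm ℤ) i < (wOf k D : Equiv.Perm ℤ) m) := by
  constructor
  · intro h
    have hm := h.not_modEq
    obtain ⟨hi, hj, ht, hl⟩ := h
    have hij : i < j := by omega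
    have hy : y = wOf k D * t k i j := by rw [← ht, mul_t_mul_t]
    have hlt : (wOf k D : Equiv.Perm ℤ) j < (wOf k D : Equiv.Perm ℤ) i := by
      rcases lt_trichotomy ((wOf k D : Equiv.Perm ℤ) i) ((wOf k D : Equiv.Perm ℤ) j) with h | h | h
      · have := lt_len_mul_t _ hij hm h
        rw [← hy] at this
        omega
      · exact absurd (Equiv.injective _ h) hij.ne
      · exact h
    have hi1 := wOf_apply_lt_window hD (v := i)
    have hi2 := window_lt_wOf_apply hD (v := i)
    have hj1 := wOf_apply_lt_window hD (v := j)
    have hj2 := window_lt_wOf_apply hD (v := j)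
    by_cases hck : c ≤ k
    · refine ⟨hy, by omega, hi, hj, by omega, hlt, fun m h1 h2 => ?_⟩
      by_contra! hcon
      have n1 : (wOf k D : Equiv.Perm ℤ) j ≠ (wOf k D : Equiv.Perm ℤ) m :=
        fun h => h2.ne' (Equiv.injective _ h)
      have n2 : (wOf k D : Equiv.Perm ℤ) m ≠ (wOf k D : Equiv.Perm ℤ) i :=
        fun h => h1.ne' (Equiv.injective _ h)
      have := len_mul_t_of_between (wOf k D) h1 h2 (by omega) (by omega) (by omega)
      rw [← hy] at this
      omega
    · -- the bounds in `hD` cannot hold if `k < c`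
      have : D = ∅ := Finset.eq_empty_of_forall_notMem fun y hy => by
        have := hD y hy
        omega
      subst this
      simp only [wOf_empty, OneMemClass.coe_one, Equiv.Perm.coe_one, id_eq] at hlt
      omega
  · rintro ⟨hy, h1, h2, h3, h4, h5, h6⟩
    refine ⟨h2, h3, by rw [hy, mul_t_mul_t], ?_⟩
    rw [hy, len_mul_t_of_not_between _ (by omega) (by omega) h5 h6]

theorem sdiff_mem_rect (hμ : ∀ y ∈ μ, y.1 + c ≤ k ∧ y.2 < c) (Y : Finset (ℕ × ℕ)) :
    ∀ y ∈ μ.cells \ Y, y.1 + c ≤ k ∧ y.2 < c :=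
  fun y hy => hμ y ((YoungDiagram.mem_cells _).1 (Finset.mem_sdiff.1 hy).1)

/-- An edge that begins at `w_{μ \ Y}` and whose label is smaller than all labels of `Y` deletes a
cell `x` of `μ`. -/
theorem HasWires.exists_of_isEdge (hμ : ∀ y ∈ μ, y.1 + c ≤ k ∧ y.2 < c)
    (hw : HasWires k c μ Y) {g : W k} {i j : ℤ} (h : IsEdge (wOf k (μ.cells \ Y)) g i j)
    (hlab : ∀ y ∈ Y, (g : Equiv.Perm ℤ) j < label μ Y y) :
    ∃ x ∈ μ, Deletable Y x ∧ i = -x.1 ∧ j = x.2 + 1 ∧ g = wOf k (μ.cells \ insert x Y) ∧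
      (g : Equiv.Perm ℤ) j = wireVal μ Y x.1 0 ∧ ∀ r < x.1,
        wireVal μ Y r 0 < colEnd μ x.2 ∨ wireVal μ Y x.1 0 < wireVal μ Y r 0 := by
  have hm := h.not_modEq
  obtain ⟨hg, h1, h2, h3, h4, h5, h6⟩ := (isEdge_wOf_iff (sdiff_mem_rect hμ Y)).1 h
  obtain ⟨r, rfl⟩ : ∃ r : ℕ, i = -(r : ℤ) := ⟨(-i).toNat, by omega⟩
  obtain ⟨b, rfl⟩ : ∃ b : ℕ, j = (b : ℤ) + 1 := ⟨(j - 1).toNat, by omega⟩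
  have hgj : (g : Equiv.Perm ℤ) (b + 1) = wireVal μ Y r 0 := by
    rw [hg, coe_mul_apply, t_apply_right hm, hw.row r (by omega)]
  rw [hgj] at hlab
  rw [hw.row r (by omega)] at h5 h6
  have hfree : ∀ y ∈ Y, y.2 ≠ b := by
    rintro y hy rfl
    have := hlab y hy
    rw [hw.col_used y hy] at h5
    omega
  rw [hw.col_free b (by omega) hfree] at h5 h6
  have hdel : Deletable Y (r, b) := by
    refine ⟨hfree, fun y hy hr => ?_⟩
    have := hr ▸ wireVal_le_colEnd (μ := μ) hy (Nat.zero_le _)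
    exact (colEnd_strictMono μ).lt_iff_lt.1 (h5.trans_le this)
  have hx : (r, b) ∈ μ := colEnd_lt_rowEnd_iff.1 (h5.trans_le (wireVal_le_rowEnd _ _ _ _))
  refine ⟨(r, b), hx, hdel, rfl, rfl, ?_, hgj, fun r' hr' => ?_⟩
  · rw [hg, wOf_sdiff_insert hμ hx hdel, cellRefl]
  · simp only at hr'
    have := h6 (-(r' : ℤ)) (by omega) (by omega)
    rwa [hw.row r' (by omega)] at this

/-- Deleting a cell gives an edge if the labels of `Y` exceed the new label, and if no row above
carries a value between the two values that are interchanged. -/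
theorem HasWires.isEdge (hμ : ∀ y ∈ μ, y.1 + c ≤ k ∧ y.2 < c)
    (hw : HasWires k c μ Y) {x : ℕ × ℕ} (hx : x ∈ μ) (hdel : Deletable Y x)
    (hlab : ∀ y ∈ Y, wireVal μ Y x.1 0 < label μ Y y)
    (hgap : ∀ r < x.1, wireVal μ Y r 0 < colEnd μ x.2 ∨ wireVal μ Y x.1 0 < wireVal μ Y r 0) :
    IsEdge (wOf k (μ.cells \ Y)) (wOf k (μ.cells \ insert x Y)) (-x.1) (x.2 + 1) := by
  obtain ⟨h1, h2⟩ := hμ x hx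
  rw [isEdge_wOf_iff (sdiff_mem_rect hμ Y), hw.row _ h1, hw.col_free _ h2 hdel.1]
  refine ⟨wOf_sdiff_insert hμ hx hdel, by omega, by omega, by omega, by omega,
    colEnd_lt_wireVal hx hdel, fun m hm1 hm2 => ?_⟩
  rcases le_or_gt m 0 with hm | hm
  · obtain ⟨r, rfl⟩ : ∃ r : ℕ, m = -(r : ℤ) := ⟨(-m).toNat, by omega⟩
    rw [hw.row r (by omega)]
    exact hgap r (by omega)
  · obtain ⟨b, rfl⟩ : ∃ b : ℕ, m = (b : ℤ) + 1 := ⟨(m - 1).toNat, by omega⟩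
    by_cases hb : ∀ y ∈ Y, y.2 ≠ b
    · rw [hw.col_free b (by omega) hb]
      exact Or.inl (colEnd_strictMono μ (by omega))
    · push Not at hb
      obtain ⟨y, hy, rfl⟩ := hb
      rw [hw.col_used y hy]
      exact Or.inr (hlab y hy)

/-- The sets of cells which strong strips delete. Besides (C1) and (C2) this records that, after
the deletion of a cell `y`, no row above `y` ever carries a value strictly between the value
`colEnd μ y.2` and the label of `y`. -/
structure Admissible (μ : YoungDiagram) (Y : Finset (ℕ × ℕ)) : Prop where
  sub : Y ⊆ μ.cells
  c1 : C1 Y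
  c2 : C2 μ Y
  gap : ∀ y ∈ Y, ∀ r < y.1, wireVal μ Y r 0 ≤ colEnd μ y.2 ∨ label μ Y y ≤ wireVal μ Y r 0

theorem Admissible.empty (μ : YoungDiagram) : Admissible μ ∅ :=
  ⟨by simp, by simp [C1], by simp [C2], by simp⟩

theorem Admissible.insert_cell (h : Admissible μ Y) {x : ℕ × ℕ} (hx : x ∈ μ)
    (hdel : Deletable Y x) (hlab : ∀ y ∈ Y, wireVal μ Y x.1 0 < label μ Y y)
    (hgap : ∀ r < x.1, wireVal μ Y r 0 < colEnd μ x.2 ∨ wireVal μ Y x.1 0 < wireVal μ Y r 0) :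
    Admissible μ (insert x Y) := by
  have hlt := colEnd_lt_wireVal hx hdel
  -- a cell of `Y` below the row of `x` lies to the right of the column of `x`
  have hbelow : ∀ y ∈ Y, x.1 < y.1 → wireVal μ Y x.1 0 ≤ colEnd μ y.2 := by
    intro y hy hr
    rcases h.gap y hy _ hr with h' | h'
    · exact h'
    · exact absurd (hlab y hy) (not_lt.2 h')
  refine ⟨?_, ?_, ?_, ?_⟩
  · intro y hy
    rcases Finset.mem_insert.1 hy with rfl | hy
    · exact (YoungDiagram.mem_cells _).2 hx
    · exact h.sub hy
  · intro y hy z hz hne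
    rcases Finset.mem_insert.1 hy with rfl | hyY <;> rcases Finset.mem_insert.1 hz with rfl | hzY
    · exact absurd rfl hne
    · exact (hdel.1 z hzY).symm
    · exact hdel.1 y hyY
    · exact h.c1 y hyY z hzY hne
  · intro y hy z hz hrow hcol
    rcases Finset.mem_insert.1 hy with rfl | hyY <;> rcases Finset.mem_insert.1 hz with rfl | hzY
    · omega
    · intro hmem
      have hz' : colEnd μ z.2 < wireVal μ Y y.1 0 := by
        rcases wireVal_eq μ Y y.1 0 with e | ⟨y', hy', hr, -, e⟩
        · rw [e]
          exact colEnd_lt_rowEnd_iff.2 hmem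
        · rw [e]
          apply colEnd_strictMono μ
          by_contra hle
          have hne : y' ≠ z := fun e => by
            rw [e] at hr
            omega
          have := h.c1 y' hy' z hzY hne
          exact h.c2 y' hy' z hzY (by omega) (by omega) (hr ▸ hmem)
      rcases hgap z.1 hrow with hg | hg
      · -- the row of `z` carries the value of a column to the left of `y`; take the rightmost one
        have hne : {z' ∈ Y | z'.1 = z.1 ∧ z'.2 < y.2}.Nonempty := by
          rcases wireVal_eq μ Y z.1 0 with e | ⟨z', hz', hr, -, e⟩
          · have := rowEnd_strictAnti μ hrow
            have := wireVal_le_rowEnd μ Y y.1 0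
            omega
          · rw [e] at hg
            exact ⟨z', Finset.mem_filter.2 ⟨hz', hr, (colEnd_strictMono μ).lt_iff_lt.1 hg⟩⟩
        obtain ⟨z', hz', hmax⟩ := Finset.exists_max_image _ (fun z' => z'.2) hne
        obtain ⟨hz'Y, hz'r, hz'c⟩ := Finset.mem_filter.1 hz'
        have h1 := hlab z' hz'Y
        have h2 : label μ Y z' ≤ colEnd μ z.2 := by
          rw [label, hz'r]
          exact wireVal_le_colEnd hzY (by omega)
        omega
      · have := wireVal_le_colEnd (μ := μ) hzY (Nat.zero_le _)
        omega
    · have h1 := hbelow y hyY hrow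
      have h2 := colEnd_strictMono μ hcol
      omega
    · exact h.c2 y hyY z hzY hrow hcol
  · intro y hy r hr
    rcases Finset.mem_insert.1 hy with rfl | hy
    · rw [wireVal_insert_of_ne hr.ne', label_insert_self hdel]
      exact (hgap r hr).imp le_of_lt le_of_lt
    · rw [label_insert_of_mem hdel hy]
      by_cases e : x.1 = r
      · subst e
        rw [wireVal_insert_zero hlt.le]
        exact Or.inl (hlt.le.trans (hbelow y hy hr))
      · rw [wireVal_insert_of_ne e]
        exact h.gap y hy r hr

/-- The cells of `X` with a greater label than `x` satisfy the conditions under which deleting `x`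
gives an edge. -/
theorem deletable_filter_label (hX : X ⊆ μ.cells) (h1 : C1 X) (h2 : C2 μ X) {x : ℕ × ℕ}
    (hx : x ∈ X) (hY : ∀ y, y ∈ Y ↔ y ∈ X ∧ label μ X x < label μ X y) :
    Deletable Y x ∧ wireVal μ Y x.1 0 = label μ X x ∧
      (∀ y ∈ Y, wireVal μ Y x.1 0 < label μ Y y) ∧
      ∀ r < x.1, wireVal μ Y r 0 < colEnd μ x.2 ∨ wireVal μ Y x.1 0 < wireVal μ Y r 0 := by
  have hmem : ∀ y ∈ X, y ∈ μ := fun y hy => (YoungDiagram.mem_cells _).1 (hX hy)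
  have hdel : Deletable Y x := by
    have hcol : ∀ y ∈ Y, y.2 ≠ x.2 := fun y hy => h1 y ((hY y).1 hy).1 x hx
      fun e => ((hY y).1 hy).2.ne (by rw [e])
    refine ⟨hcol, fun y hy hr => ?_⟩
    by_contra hlt
    have := hcol y hy
    exact ((hY y).1 hy).2.not_gt (label_lt_label (hmem x hx) hx hr (by omega))
  have hval : wireVal μ Y x.1 0 = label μ X x := by
    refine wireVal_congr fun y hy => ⟨fun h => ?_, fun h => ?_⟩
    · exact ⟨((hY y).1 h.1).1, hdel.2 y h.1 hy⟩
    · exact ⟨(hY y).2 ⟨h.1, label_lt_label (hmem y h.1) h.1 hy.symm h.2⟩, Nat.zero_le _⟩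
  have hlab : ∀ y ∈ Y, label μ Y y = label μ X y := by
    intro y hy
    refine wireVal_congr fun z hz => ⟨fun h => ⟨((hY z).1 h.1).1, h.2⟩, fun h => ⟨?_, h.2⟩⟩
    exact (hY z).2 ⟨h.1, ((hY y).1 hy).2.trans (label_lt_label (hmem z h.1) h.1 hz.symm h.2)⟩
  refine ⟨hdel, hval, fun y hy => ?_, fun r hr => ?_⟩
  · rw [hval, hlab y hy]
    exact ((hY y).1 hy).2
  · have hle := wireVal_le_rowEnd μ Y x.1 0
    rcases wireVal_eq μ Y r 0 with e | ⟨y, hy, rfl, -, e⟩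
    · have := rowEnd_strictAnti μ hr
      exact Or.inr (by omega)
    · rw [e]
      rcases lt_or_gt_of_ne (hdel.1 y hy) with h | h
      · exact Or.inl (colEnd_strictMono μ h)
      · have := rowEnd_lt_colEnd (h2 x hx y ((hY y).1 hy).1 hr h)
        simp only at this
        exact Or.inr (by omega)

end Edges

/-! ### Strong strips and sets of cells -/

section Strips

variable {k c n : ℕ} {μ : YoungDiagram}

open Classical in
theorem mem_cellSets {X : Finset (ℕ × ℕ)} :
    X ∈ cellSets μ n ↔ (X ⊆ μ.cells ∧ X.card = n) ∧ C1 X ∧ C2 μ X := by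
  rw [cellSets, Finset.mem_filter, Finset.mem_powersetCard]

/-- The cells `x b` with `b < a`: those which the first `a` edges of a strip delete. -/
def initialCells (x : Fin n → ℕ × ℕ) (a : Fin (n + 1)) : Finset (ℕ × ℕ) :=
  (Finset.univ.filter fun b : Fin n => b.castSucc < a).image x

theorem mem_initialCells {x : Fin n → ℕ × ℕ} {a : Fin (n + 1)} {y : ℕ × ℕ} :
    y ∈ initialCells x a ↔ ∃ b : Fin n, b.castSucc < a ∧ x b = y := by
  simp [initialCells]

theorem initialCells_zero (x : Fin n → ℕ × ℕ) : initialCells x 0 = ∅ := by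
  simp [initialCells]

theorem initialCells_last (x : Fin n → ℕ × ℕ) :
    initialCells x (Fin.last n) = Finset.univ.image x := by
  simp [initialCells, Fin.castSucc_lt_last]

theorem initialCells_succ (x : Fin n → ℕ × ℕ) (a : Fin n) :
    initialCells x a.succ = insert (x a) (initialCells x a.castSucc) := by
  rw [initialCells, initialCells, ← Finset.image_insert]
  congr 1
  ext b
  simp only [Finset.mem_filter, Finset.mem_univ, true_and, Finset.mem_insert, Fin.lt_def,
    Fin.ext_iff, Fin.val_castSucc, Fin.val_succ]
  omega

/-- The cell in the row and the column to whose positions the `b`-th edge of a strip belongs. -/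
def StrongStrip.cell {w : W k} (p : StrongStrip k n w) (b : Fin n) : ℕ × ℕ :=
  ((-(p.edge b).1).toNat, ((p.edge b).2 - 1).toNat)

theorem StrongStrip.edge_eq {w : W k} (p : StrongStrip k n w) (b : Fin n) :
    p.edge b = (-((p.cell b).1 : ℤ), ((p.cell b).2 : ℤ) + 1) := by
  obtain ⟨h1, h2, -⟩ := p.isEdge b
  ext <;> simp only [cell] <;> omega

/-- The vertices of a strip that begins at `w_μ` are the elements of the diagrams with deleted
cells, and the label of an edge is that of its cell in the set of the cells deleted so far. -/
theorem StrongStrip.invariant (hc : c ≤ k) (hμ : ∀ y ∈ μ, y.1 + c ≤ k ∧ y.2 < c)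
    (p : StrongStrip k n (wOf k μ.cells)) (a : Fin (n + 1)) :
    Admissible μ (initialCells p.cell a) ∧ HasWires k c μ (initialCells p.cell a) ∧
      p.vertex a = wOf k (μ.cells \ initialCells p.cell a) ∧
      ∀ b : Fin n, b.castSucc < a → label μ (initialCells p.cell a) (p.cell b)
        = (p.vertex b.succ : Equiv.Perm ℤ) (p.edge b).2 := by
  induction a using Fin.induction with
  | zero =>
    rw [initialCells_zero]
    exact ⟨Admissible.empty μ, HasWires.empty hμ hc, by rw [p.vertex_zero, Finset.sdiff_empty],
      fun b hb => absurd hb (Fin.not_lt_zero _)⟩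
  | succ a ih =>
    obtain ⟨hadm, hw, hv, hl⟩ := ih
    have he := p.isEdge a
    rw [hv] at he
    have hlab : ∀ y ∈ initialCells p.cell a.castSucc,
        (p.vertex a.succ : Equiv.Perm ℤ) (p.edge a).2
          < label μ (initialCells p.cell a.castSucc) y := by
      intro y hy
      obtain ⟨b, hb, rfl⟩ := mem_initialCells.1 hy
      rw [hl b hb]
      exact p.label_strictAnti (Fin.castSucc_lt_castSucc_iff.1 hb)
    obtain ⟨x, hx, hdel, hi, hj, hg, hval, hgap⟩ := hw.exists_of_isEdge hμ he hlab
    have hcell : p.cell a = x := by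
      ext <;> simp only [cell, hi, hj] <;> omega
    rw [initialCells_succ, hcell]
    refine ⟨hadm.insert_cell hx hdel (fun y hy => hval ▸ hlab y hy) hgap,
      hw.insert_cell hμ hadm.sub hx hdel, hg, fun b hb => ?_⟩
    rcases (Fin.le_castSucc_iff.2 hb).lt_or_eq with h | h
    · rw [label_insert_of_mem hdel (mem_initialCells.2 ⟨b, h, rfl⟩), hl b h]
    · rw [Fin.castSucc_inj.1 h, hcell, hval, label_insert_self hdel]

/-- The set of cells which a strip deletes. -/
def StrongStrip.cells {w : W k} (p : StrongStrip k n w) : Finset (ℕ × ℕ) :=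
  Finset.univ.image p.cell

theorem StrongStrip.label_cells_strictAnti (hc : c ≤ k) (hμ : ∀ y ∈ μ, y.1 + c ≤ k ∧ y.2 < c)
    (p : StrongStrip k n (wOf k μ.cells)) :
    StrictAnti fun b => label μ p.cells (p.cell b) := by
  have h := (p.invariant hc hμ (Fin.last n)).2.2.2
  rw [initialCells_last] at h
  intro a b hab
  simp only [cells]
  rw [h a (Fin.castSucc_lt_last a), h b (Fin.castSucc_lt_last b)]
  exact p.label_strictAnti hab

theorem StrongStrip.cell_injective (hc : c ≤ k) (hμ : ∀ y ∈ μ, y.1 + c ≤ k ∧ y.2 < c)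
    (p : StrongStrip k n (wOf k μ.cells)) : Function.Injective p.cell := fun a b h =>
  (p.label_cells_strictAnti hc hμ).injective (by simp only [h])

theorem StrongStrip.cells_mem_cellSets (hc : c ≤ k) (hμ : ∀ y ∈ μ, y.1 + c ≤ k ∧ y.2 < c)
    (p : StrongStrip k n (wOf k μ.cells)) : p.cells ∈ cellSets μ n := by
  have h := (p.invariant hc hμ (Fin.last n)).1
  rw [initialCells_last] at h
  refine mem_cellSets.2 ⟨⟨h.sub, ?_⟩, h.c1, h.c2⟩
  rw [cells, Finset.card_image_of_injective _ (p.cell_injective hc hμ), Finset.card_univ,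
    Fintype.card_fin]

/-- A strip is determined by its set of cells: the order of the cells is that of decreasing
labels, and the labels depend on the set only. -/
theorem StrongStrip.cells_injective (hc : c ≤ k) (hμ : ∀ y ∈ μ, y.1 + c ≤ k ∧ y.2 < c) :
    Function.Injective (StrongStrip.cells (k := k) (n := n) (w := wOf k μ.cells)) := by
  intro p q hpq
  have hp := p.label_cells_strictAnti hc hμ
  have hq := q.label_cells_strictAnti hc hμ
  rw [← hpq] at hq
  have hrange : Set.range p.cell = Set.range q.cell := by
    have h1 := congrArg (fun s : Finset (ℕ × ℕ) => (s : Set (ℕ × ℕ))) hpq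
    simpa [cells] using h1
  have hlab : (fun b => label μ p.cells (p.cell b)) = fun b => label μ p.cells (q.cell b) := by
    refine (StrictAnti.range_inj hp hq).1 ?_
    have h1 := congrArg (Set.image (label μ p.cells)) hrange
    rwa [← Set.range_comp, ← Set.range_comp] at h1
  have hX := mem_cellSets.1 (p.cells_mem_cellSets hc hμ)
  have hcell : p.cell = q.cell := by
    funext b
    refine label_injOn hX.1.1 hX.2.1 ?_ ?_ (congrFun hlab b)
    · exact Finset.mem_coe.2 (Finset.mem_image_of_mem _ (Finset.mem_univ b))
    · rw [hpq]
      exact Finset.mem_coe.2 (Finset.mem_image_of_mem _ (Finset.mem_univ b))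
  ext1
  · funext a
    rw [(p.invariant hc hμ a).2.2.1, (q.invariant hc hμ a).2.2.1, hcell]
  · funext b
    rw [p.edge_eq, q.edge_eq, hcell]

/-- The cells of a set of `cellSets μ n` in the order of decreasing labels. -/
theorem exists_label_strictAnti {X : Finset (ℕ × ℕ)} (hX : X ∈ cellSets μ n) :
    ∃ x : Fin n → ℕ × ℕ, Finset.univ.image x = X ∧ StrictAnti fun b => label μ X (x b) := by
  obtain ⟨⟨hsub, hcard⟩, h1, -⟩ := mem_cellSets.1 hX
  have hinj := label_injOn hsub h1
  have hL : (X.image (label μ X)).card = n := by rw [Finset.card_image_of_injOn hinj, hcard]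
  have hex : ∀ b : Fin n, ∃ x ∈ X, label μ X x = (X.image (label μ X)).orderEmbOfFin hL b.rev :=
    fun b => Finset.mem_image.1 (Finset.orderEmbOfFin_mem _ hL _)
  choose x hxX hx using hex
  have hanti : StrictAnti fun b => label μ X (x b) := by
    intro a b hab
    simp only [hx]
    exact (Finset.orderEmbOfFin _ hL).strictMono (Fin.rev_lt_rev.2 hab)
  refine ⟨x, Finset.eq_of_subset_of_card_le ?_ ?_, hanti⟩
  · intro y hy
    obtain ⟨b, -, rfl⟩ := Finset.mem_image.1 hy
    exact hxX b
  · rw [Finset.card_image_of_injective _ (fun a b h => hanti.injective (by simp only [h])),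
      Finset.card_univ, Fintype.card_fin, hcard]

/-- Deleting the cells of `X` in the order of decreasing labels is a strip. -/
theorem exists_strip_of_mem_cellSets (hc : c ≤ k) (hμ : ∀ y ∈ μ, y.1 + c ≤ k ∧ y.2 < c)
    {X : Finset (ℕ × ℕ)} (hX : X ∈ cellSets μ n) :
    ∃ p : StrongStrip k n (wOf k μ.cells), p.cells = X := by
  obtain ⟨x, hxX, hanti⟩ := exists_label_strictAnti hX
  obtain ⟨⟨hsub, -⟩, h1, h2⟩ := mem_cellSets.1 hX
  have hx : ∀ b, x b ∈ X := fun b => hxX ▸ Finset.mem_image_of_mem _ (Finset.mem_univ b)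
  have hY : ∀ (a : Fin n) (y : ℕ × ℕ), y ∈ initialCells x a.castSucc ↔
      y ∈ X ∧ label μ X (x a) < label μ X y := by
    intro a y
    rw [mem_initialCells]
    constructor
    · rintro ⟨b, hb, rfl⟩
      exact ⟨hx b, hanti (Fin.castSucc_lt_castSucc_iff.1 hb)⟩
    · rintro ⟨hy, hlt⟩
      rw [← hxX] at hy
      obtain ⟨b, -, rfl⟩ := Finset.mem_image.1 hy
      exact ⟨b, Fin.castSucc_lt_castSucc_iff.2 (hanti.lt_iff_gt.1 hlt), rfl⟩
  have hmem : ∀ b, x b ∈ μ := fun b => (YoungDiagram.mem_cells _).1 (hsub (hx b))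
  have hstep := fun a => deletable_filter_label hsub h1 h2 (hx a) (hY a)
  have hw : ∀ a, HasWires k c μ (initialCells x a) := by
    intro a
    induction a using Fin.induction with
    | zero =>
      rw [initialCells_zero]
      exact HasWires.empty hμ hc
    | succ a ih =>
      rw [initialCells_succ]
      exact ih.insert_cell hμ (fun y hy => hsub ((hY a y).1 hy).1) (hmem a) (hstep a).1
  have hlabel : ∀ a : Fin n, (wOf k (μ.cells \ initialCells x a.succ) : Equiv.Perm ℤ) ((x a).2 + 1)
      = label μ X (x a) := by
    intro a
    rw [(hw a.succ).col_used _ (mem_initialCells.2 ⟨a, Fin.castSucc_lt_succ, rfl⟩),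
      initialCells_succ, label_insert_self (hstep a).1, (hstep a).2.1]
  refine ⟨⟨fun a => wOf k (μ.cells \ initialCells x a),
    fun b => (-((x b).1 : ℤ), ((x b).2 : ℤ) + 1),
    by rw [initialCells_zero, Finset.sdiff_empty], fun a => ?_, fun a b hab => ?_⟩, ?_⟩
  · rw [initialCells_succ]
    exact (hw a.castSucc).isEdge hμ (hmem a) (hstep a).1 (hstep a).2.2.1 (hstep a).2.2.2
  · simp only [hlabel]
    exact hanti hab
  · refine Eq.trans ?_ hxX
    rw [StrongStrip.cells]
    congr 1
    funext b
    ext <;> simp [StrongStrip.cell]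

theorem StrongStrip.len_vertex {w : W k} (p : StrongStrip k n w) (a : Fin (n + 1)) :
    len (p.vertex a) + a = len w := by
  induction a using Fin.induction with
  | zero => simp [p.vertex_zero]
  | succ a ih =>
    have := (p.isEdge a).2.2.2
    simp only [Fin.val_castSucc, Fin.val_succ] at ih ⊢
    omega

/-- The element at which a strip ends, with the reading word of the remaining cells as a reduced
word. -/
theorem StrongStrip.u_last_eq {R : Type*} [CommRing R] (hc : c ≤ k)
    (hμ : ∀ y ∈ μ, y.1 + c ≤ k ∧ y.2 < c) (p : StrongStrip k n (wOf k μ.cells)) :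
    u R p.last = uOf R k (μ.cells \ p.cells) := by
  have h := (p.invariant hc hμ (Fin.last n)).2.2.1
  have hlen := p.len_vertex (Fin.last n)
  rw [initialCells_last] at h
  change _ = wOf k (μ.cells \ p.cells) at h
  have hX := (mem_cellSets.1 (p.cells_mem_cellSets hc hμ)).1
  rw [len_wOf_of_isLowerSet (fun y hy => hμ y ((YoungDiagram.mem_cells _).1 hy))
    μ.isLowerSet] at hlen
  rw [last, uOf_eq_u, h]
  rw [Finset.card_sdiff_of_subset hX.1, ← h, hX.2]
  simp only [Fin.val_last] at hlen
  omega

end Strips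

end DownOp

theorem theorem3p2 {R : Type*} [CommRing R] (k : ℕ) (hk : 1 ≤ k) (c : ℕ) (hc : c ≤ k)
    (μ : YoungDiagram) (hμ : μ ≤ DownOp.kRectangle k c) (n : ℕ) :
    DownOp.downOp R k n (DownOp.uOf R k μ.cells)
        = ∑ X ∈ DownOp.cellSets μ n, DownOp.uOf R k (μ.cells \ X) ∧
    ∃ e : DownOp.StrongStrip k n (DownOp.wOf k μ.cells) ≃ DownOp.cellSets μ n,
      ∀ p : DownOp.StrongStrip k n (DownOp.wOf k μ.cells),
        DownOp.u R p.last = DownOp.uOf R k (μ.cells \ (e p : Finset (ℕ × ℕ))) ∧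
        ∃ x : Fin n → ℕ × ℕ, Function.Injective x ∧
          Finset.univ.image x = (e p : Finset (ℕ × ℕ)) ∧
          ∀ a : Fin (n + 1), p.vertex a =
            DownOp.wOf k (μ.cells \ (Finset.univ.filter fun b : Fin n => b.castSucc < a).image x) := by
  have hrect : ∀ y ∈ μ, y.1 + c ≤ k ∧ y.2 < c := fun y hy => DownOp.mem_rect_of_le hc hμ hy
  let e : DownOp.StrongStrip k n (DownOp.wOf k μ.cells) ≃ DownOp.cellSets μ n :=
    Equiv.ofBijective (fun p => ⟨p.cells, p.cells_mem_cellSets hc hrect⟩)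
      ⟨fun p q h => DownOp.StrongStrip.cells_injective hc hrect (congrArg Subtype.val h),
        fun X => by
          obtain ⟨p, hp⟩ := DownOp.exists_strip_of_mem_cellSets hc hrect X.2
          exact ⟨p, Subtype.ext hp⟩⟩
  refine ⟨?_, e, fun p => ⟨p.u_last_eq hc hrect, p.cell, p.cell_injective hc hrect, rfl,
    fun a => (p.invariant hc hrect a).2.2.1⟩⟩
  rw [DownOp.uOf_eq_u (DownOp.len_wOf_of_isLowerSet
      (fun y hy => hrect y ((YoungDiagram.mem_cells _).1 hy)) μ.isLowerSet),
    DownOp.downOp, DownOp.extend_u, ← Finset.sum_coe_sort (DownOp.cellSets μ n)]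
  exact Fintype.sum_equiv e _ _ fun p => p.u_last_eq hc hrect
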